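/- **Setting.** Let $n>1$ and $N>1$ be natural numbers, and let $a_k>0$, $\beta_k$, $d_k$ ($k=1,\dots,N$) be real numbers with $\sum_{k=1}^N a_k=1$ and $\sum_{k=1}^N a_k|d_k|^2<1$. Put $\alpha_0=0$, $\alpha_k=\alpha_{k-1}+a_k$. Assume that at least one $\beta_k$ is nonzero and that exactly one of the numbers $d_k$, namely $d_m$, is nonzero. Let $P\in L_2[0,1]$ be the affinely self-similar function with these parameters, i.e. the solution of $$P(x)=\sum_{k=1}^N \chi_{(\alpha_{k-1},\alpha_k)}(x)\Bigl(\beta_k+d_k\,P\bigl((x-\alpha_{k-1})/a_k\bigr)\Bigr)\quad\text{for a.e. }x\in[0,1],$$ and assume that $P$ is not piecewise constant with finitely many points of discontinuity. Let $\rho=P'$ be its generalized derivative, and consider the boundary value problem $$(-1)^n y^{(2n)}-\lambda\rho y=0,\qquad y^{(k)}(0)=y^{(k)}(1)=0,\quad 0\le k<n.$$ Let $\mathfrak H$ be the complex Sobolev space of functions $y$ on $[0,1]$ with absolutely continuous $y^{(n-1)}$, $y^{(n)}\in L_2[0,1]$ and these boundary values. A number $\lambda$ is an eigenvalue if there is a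 nonzero $y\in\mathfrak H$ with $$\int_0^1\bigl(y^{(n)}\,\overline{z^{(n)}}+\lambda P\cdot(y\overline z)'\bigr)\,dx=0\qquad\text{for all } z\in\mathfrak H;$$ its multiplicity is the dimension of the space of such $y$. For $k=1,\dots,N-1$ put $$\zeta_k=\begin{cases}\beta_m-\beta_{m-1}+d_m\beta_1,&k=m-1,\\ \beta_{m+1}-\beta_m-d_m\beta_N,&k=m,\\ \beta_{k+1}-\beta_k&\text{otherwise,}\end{cases}\qquad \mathrm Z_\pm=\#\{k\in[1,N-1]:\pm\zeta_k>0\}.$$ **Theorem.** Suppose $d_m>0$, $\mathrm Z_->0$ and $\mathrm Z_++\mathrm Z_-=N-1$. Then every negative eigenvalue has finite multiplicity, the negative eigenvalues, numbered in decreasing order with multiplicity, form an infinite sequence $\lambda_{-1}\ge\lambda_{-2}\ge\cdots$ (containing each of them), and there are real numbers $\tau_l>0$, $l=1,\dots,\mathrm Z_-$, such that for every $l=1,\dots,\mathrm Z_-$ $$\lambda_{-(l+k\mathrm Z_-)}=-\tau_l\,(a_m^{2n-1}d_m)^{-k}\,(1+o(1))\qquad (k\to\infty).$$ -/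

import Mathlib

namespace SelfSimilarSpectrum

open MeasureTheory Set Filter Topology

/-- Lebesgue measure on `[0, 1]`. -/
noncomputable abbrev unitMeasure : Measure ℝ := volume.restrict (Icc (0 : ℝ) 1)

/-- The real space `L₂[0, 1]`. -/
noncomputable abbrev L2 : Type := Lp ℝ 2 unitMeasure

/-! ### Self-similar functions

The parameters `a_k`, `β_k`, `d_k` are indexed by `k = 1, …, N`; values of the sequences `a`, `β`,
`d` outside this range play no role. -/

/-- The partition points `α_0 = 0`, `α_k = α_{k-1} + a_k`. -/
noncomputable def node (a : ℕ → ℝ) (k : ℕ) : ℝ := ∑ i ∈ Finset.Icc 1 k, a i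

/-- The similarity operator
`G(f) = ∑_{k=1}^N { β_k χ_{(α_{k-1}, α_k)} + d_k G_k(f) }`, where `G_k(f)` equals
`f((x - α_{k-1}) / a_k)` on `(α_{k-1}, α_k)` and vanishes elsewhere. -/
noncomputable def similarityOp (N : ℕ) (a β d : ℕ → ℝ) (f : ℝ → ℝ) (x : ℝ) : ℝ :=
  ∑ k ∈ Finset.Icc 1 N,
    (Ioo (node a (k - 1)) (node a k)).indicator
      (fun t => β k + d k * f ((t - node a (k - 1)) / a k)) x

/-- `P` is the affinely self-similar function with the given parameters: the similarity operator
is a contraction of `L₂[0, 1]` (that is, `∑ a_k |d_k|² < 1`) and `P` is its fixed point. -/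
structure IsSelfSimilar (N : ℕ) (a β d : ℕ → ℝ) (P : L2) : Prop where
  one_lt : 1 < N
  a_pos : ∀ k ∈ Finset.Icc 1 N, 0 < a k
  sum_a : ∑ k ∈ Finset.Icc 1 N, a k = 1
  contraction : ∑ k ∈ Finset.Icc 1 N, a k * |d k| ^ 2 < 1
  fixed : (P : ℝ → ℝ) =ᵐ[unitMeasure] similarityOp N a β d P

/-- `P` is (almost everywhere) piecewise constant with finitely many points of discontinuity. -/
def IsTrivial (P : L2) : Prop :=
  ∃ (s : Finset ℝ) (g : ℝ → ℝ), (P : ℝ → ℝ) =ᵐ[unitMeasure] g ∧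
    ∀ x ∈ Icc (0 : ℝ) 1, x ∉ s → ∀ᶠ t in 𝓝[Icc (0 : ℝ) 1] x, g t = g x

/-- `P` is a self-similar function of zero spectral order; `m` is the only index with
`d_m ≠ 0`. -/
structure IsZeroSpectralOrder (N : ℕ) (a β d : ℕ → ℝ) (m : ℕ) (P : L2) : Prop
    extends IsSelfSimilar N a β d P where
  nontrivial : ¬ IsTrivial P
  exists_β : ∃ k ∈ Finset.Icc 1 N, β k ≠ 0
  m_mem : m ∈ Finset.Icc 1 N
  d_m : d m ≠ 0
  d_eq_zero : ∀ k ∈ Finset.Icc 1 N, k ≠ m → d k = 0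

/-- The quantities `ζ_k`, `k = 1, …, N - 1`. -/
noncomputable def zeta (N : ℕ) (β d : ℕ → ℝ) (m k : ℕ) : ℝ :=
  if k + 1 = m then β m - β (m - 1) + d m * β 1
  else if k = m then β (m + 1) - β m - d m * β N
  else β (k + 1) - β k

/-- `Z_+ = #{k ∈ [1, N-1] : ζ_k > 0}`. -/
noncomputable def Zpos (N : ℕ) (β d : ℕ → ℝ) (m : ℕ) : ℕ :=
  ((Finset.Icc 1 (N - 1)).filter fun k => 0 < zeta N β d m k).card

/-- `Z_- = #{k ∈ [1, N-1] : ζ_k < 0}`. -/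
noncomputable def Zneg (N : ℕ) (β d : ℕ → ℝ) (m : ℕ) : ℕ :=
  ((Finset.Icc 1 (N - 1)).filter fun k => zeta N β d m k < 0).card

/-! ### The boundary value problem -/

/-- The complex Sobolev space of order `n ≥ 1` with zero boundary values on `[0, 1]`: functions
with `n - 1` continuous derivatives, whose derivative of order `n - 1` is absolutely continuous on
`[0, 1]` with derivative in `L₂[0, 1]`, and with `y^{(k)}(0) = y^{(k)}(1) = 0` for `0 ≤ k < n`.
Elements are normalised to be zero outside `[0, 1]`; because of the boundary conditions,
the extension by zero keeps the `n - 1` continuous derivatives. -/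
def sobolevZero (n : ℕ) : Submodule ℂ (ℝ → ℂ) where
  carrier := {y | (∀ x, x ∉ Icc (0 : ℝ) 1 → y x = 0) ∧
    ContDiff ℝ (n - 1 : ℕ) y ∧
    (∃ u : ℝ → ℂ, MemLp u 2 unitMeasure ∧
      ∀ x ∈ Icc (0 : ℝ) 1, iteratedDeriv (n - 1) y x = ∫ t in (0 : ℝ)..x, u t) ∧
    ∀ k < n, iteratedDeriv k y 0 = 0 ∧ iteratedDeriv k y 1 = 0}
  zero_mem' := by
    have h0 : ∀ k x, iteratedDeriv k (0 : ℝ → ℂ) x = 0 := by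
      intro k x
      have : (0 : ℝ → ℂ) = fun _ => 0 := rfl
      rw [this, iteratedDeriv_const]; simp
    exact ⟨fun x _ => rfl, contDiff_const, ⟨0, MemLp.zero, fun x _ => by simp [h0]⟩,
      fun k _ => ⟨h0 k 0, h0 k 1⟩⟩
  add_mem' := by
    rintro y z ⟨y1, y2, ⟨u, hu, hyu⟩, y4⟩ ⟨z1, z2, ⟨v, hv, hzv⟩, z4⟩
    have hadd : ∀ k ≤ n - 1, ∀ x,
        iteratedDeriv k (y + z) x = iteratedDeriv k y x + iteratedDeriv k z x := by
      intro k hk x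
      have hk' : ((k : ℕ) : WithTop ℕ∞) ≤ ((n - 1 : ℕ) : WithTop ℕ∞) := by exact_mod_cast hk
      exact iteratedDeriv_add ((y2.of_le hk').contDiffAt) ((z2.of_le hk').contDiffAt)
    refine ⟨fun x hx => by simp [y1 x hx, z1 x hx], y2.add z2, ⟨u + v, hu.add hv, ?_⟩, ?_⟩
    · intro x hx
      have hint : ∀ w : ℝ → ℂ, MemLp w 2 unitMeasure → IntervalIntegrable w volume 0 x := by
        intro w hw
        have : IntegrableOn w (Icc 0 1) volume := hw.integrable (by norm_num)
        rw [intervalIntegrable_iff_integrableOn_Icc_of_le hx.1]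
        exact this.mono_set (Icc_subset_Icc_right hx.2)
      rw [hadd _ le_rfl, hyu x hx, hzv x hx]
      exact (intervalIntegral.integral_add (hint u hu) (hint v hv)).symm
    · intro k hk
      have hk' : k ≤ n - 1 := by omega
      simp [hadd k hk', y4 k hk, z4 k hk]
  smul_mem' := by
    rintro c y ⟨y1, y2, ⟨u, hu, hyu⟩, y4⟩
    have hsmul : ∀ k ≤ n - 1, ∀ x, iteratedDeriv k (c • y) x = c • iteratedDeriv k y x := by
      intro k hk x
      have hk' : ((k : ℕ) : WithTop ℕ∞) ≤ ((n - 1 : ℕ) : WithTop ℕ∞) := by exact_mod_cast hk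
      exact iteratedDeriv_const_smul ((y2.of_le hk').contDiffAt) c
    refine ⟨fun x hx => by simp [y1 x hx], y2.const_smul c, ⟨c • u, hu.const_smul c, ?_⟩, ?_⟩
    · intro x hx
      rw [hsmul _ le_rfl, hyu x hx]
      exact (intervalIntegral.integral_smul c u).symm
    · intro k hk
      have hk' : k ≤ n - 1 := by omega
      simp [hsmul k hk', y4 k hk]

/-- The sesquilinear form of the linear pencil `T_ρ(λ)`, `ρ = P'`, with respect to the duality
given by `L₂[0, 1]`:
`∫_0^1 ( y^{(n)} \overline{z^{(n)}} + λ P (y \overline z)' ) dx`. Its values at `z = y` are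
`∫_0^1 ( |y^{(n)}|² + λ P (|y|²)' ) dx`. -/
noncomputable def pencilForm (n : ℕ) (P : L2) (lam : ℂ) (y z : ℝ → ℂ) : ℂ :=
  ∫ x in (0 : ℝ)..1,
    (iteratedDeriv n y x * starRingEnd ℂ (iteratedDeriv n z x) +
      lam * (((P : ℝ → ℝ) x : ℝ) : ℂ) * deriv (fun t => y t * starRingEnd ℂ (z t)) x)

section helpers

variable {n : ℕ} {P : L2} {lam : ℂ} {y z w : ℝ → ℂ}

theorem ae_hasDerivAt (hy : y ∈ sobolevZero n) :
    ∃ u : ℝ → ℂ, MemLp u 2 unitMeasure ∧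
      ∀ᵐ x ∂unitMeasure, HasDerivAt (iteratedDeriv (n - 1) y) (u x) x := by
  obtain ⟨-, -, ⟨u, hu, h⟩, -⟩ := hy
  refine ⟨u, hu, ?_⟩
  have hI : IntervalIntegrable u volume 0 1 := by
    rw [intervalIntegrable_iff_integrableOn_Icc_of_le zero_le_one]
    exact hu.integrable (by norm_num)
  have h1 := hI.ae_hasDerivAt_integral
  have h2 : ∀ᵐ x ∂unitMeasure, x ∈ Ioo (0 : ℝ) 1 := by
    rw [unitMeasure, ← Measure.restrict_congr_set Ioo_ae_eq_Icc]
    exact ae_restrict_mem measurableSet_Ioo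
  filter_upwards [ae_restrict_of_ae h1, h2] with x hx hx01
  have h3 := hx (by rw [uIcc_of_le zero_le_one]; exact Ioo_subset_Icc_self hx01)
    0 (by simp)
  refine h3.congr_of_eventuallyEq ?_
  filter_upwards [Ioo_mem_nhds hx01.1 hx01.2] with t ht
  exact h t (Ioo_subset_Icc_self ht)

theorem iteratedDeriv_eq_deriv (hn : 1 < n) :
    iteratedDeriv n y = deriv (iteratedDeriv (n - 1) y) := by
  rw [← iteratedDeriv_succ]; congr 1; omega

theorem memLp_iteratedDeriv (hn : 1 < n) (hy : y ∈ sobolevZero n) :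
    MemLp (iteratedDeriv n y) 2 unitMeasure := by
  obtain ⟨u, hu, h⟩ := ae_hasDerivAt hy
  refine hu.ae_eq ?_
  filter_upwards [h] with x hx
  rw [iteratedDeriv_eq_deriv hn, hx.deriv]

theorem contDiff_one (hn : 1 < n) (hy : y ∈ sobolevZero n) : ContDiff ℝ 1 y :=
  hy.2.1.of_le (by exact_mod_cast (by omega : 1 ≤ n - 1))

theorem integrand_integrable (hn : 1 < n) (hy : y ∈ sobolevZero n) (hz : z ∈ sobolevZero n) :
    IntervalIntegrable (fun x =>
      iteratedDeriv n y x * starRingEnd ℂ (iteratedDeriv n z x) +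
      lam * (((P : ℝ → ℝ) x : ℝ) : ℂ) * deriv (fun t => y t * starRingEnd ℂ (z t)) x)
      volume 0 1 := by
  rw [intervalIntegrable_iff_integrableOn_Icc_of_le zero_le_one]
  refine Integrable.add ?_ ?_
  · have hz' : MemLp (fun x => starRingEnd ℂ (iteratedDeriv n z x)) 2 unitMeasure :=
      (memLp_iteratedDeriv hn hz).star
    exact (memLp_iteratedDeriv hn hy).integrable_mul hz'
  · have hc : ContDiff ℝ 1 (fun t => y t * starRingEnd ℂ (z t)) :=
      (contDiff_one hn hy).mul (Complex.conjCLE.contDiff.comp (contDiff_one hn hz))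
    have hP : IntegrableOn (fun x => lam * (((P : ℝ → ℝ) x : ℝ) : ℂ)) (Icc 0 1) volume :=
      (((Lp.memLp P).integrable (by norm_num)).ofReal).const_mul lam
    exact hP.mul_continuousOn (hc.continuous_deriv le_rfl).continuousOn isCompact_Icc

theorem pencilForm_add (hn : 1 < n) (hy : y ∈ sobolevZero n) (hw : w ∈ sobolevZero n)
    (hz : z ∈ sobolevZero n) :
    pencilForm n P lam (y + w) z = pencilForm n P lam y z + pencilForm n P lam w z := by
  unfold pencilForm
  rw [← intervalIntegral.integral_add (integrand_integrable hn hy hz)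
    (integrand_integrable hn hw hz)]
  obtain ⟨u, -, hu⟩ := ae_hasDerivAt hy
  obtain ⟨v, -, hv⟩ := ae_hasDerivAt hw
  rw [intervalIntegral.integral_of_le zero_le_one, intervalIntegral.integral_of_le zero_le_one,
    ← integral_Icc_eq_integral_Ioc, ← integral_Icc_eq_integral_Ioc]
  refine integral_congr_ae ?_
  filter_upwards [hu, hv] with x hux hvx
  have e1 : iteratedDeriv (n - 1) (y + w) = iteratedDeriv (n - 1) y + iteratedDeriv (n - 1) w := by
    ext t; exact iteratedDeriv_add hy.2.1.contDiffAt hw.2.1.contDiffAt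
  have e2 : iteratedDeriv n (y + w) x = iteratedDeriv n y x + iteratedDeriv n w x := by
    rw [iteratedDeriv_eq_deriv hn, iteratedDeriv_eq_deriv hn, iteratedDeriv_eq_deriv hn, e1,
      (hux.add hvx).deriv, hux.deriv, hvx.deriv]
  have dz : Differentiable ℝ fun t => starRingEnd ℂ (z t) :=
    (Complex.conjCLE.contDiff.comp (contDiff_one hn hz)).differentiable (by norm_num)
  have dy : Differentiable ℝ y := (contDiff_one hn hy).differentiable (by norm_num)
  have dw : Differentiable ℝ w := (contDiff_one hn hw).differentiable (by norm_num)
  have e3 : deriv (fun t => (y + w) t * starRingEnd ℂ (z t)) x =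
      deriv (fun t => y t * starRingEnd ℂ (z t)) x +
        deriv (fun t => w t * starRingEnd ℂ (z t)) x := by
    have h := ((dy x).hasDerivAt.fun_mul (dz x).hasDerivAt).fun_add
      ((dw x).hasDerivAt.fun_mul (dz x).hasDerivAt)
    rw [((dy x).hasDerivAt.fun_mul (dz x).hasDerivAt).deriv,
      ((dw x).hasDerivAt.fun_mul (dz x).hasDerivAt).deriv, ← h.deriv]
    congr 1; ext t; simp [add_mul]
  simp only [e2, e3]; ring

theorem pencilForm_smul (hn : 1 < n) (c : ℂ) (hy : y ∈ sobolevZero n)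
    (hz : z ∈ sobolevZero n) :
    pencilForm n P lam (c • y) z = c * pencilForm n P lam y z := by
  unfold pencilForm
  rw [← intervalIntegral.integral_const_mul]
  obtain ⟨u, -, hu⟩ := ae_hasDerivAt hy
  rw [intervalIntegral.integral_of_le zero_le_one, intervalIntegral.integral_of_le zero_le_one,
    ← integral_Icc_eq_integral_Ioc, ← integral_Icc_eq_integral_Ioc]
  refine integral_congr_ae ?_
  filter_upwards [hu] with x hux
  have e1 : iteratedDeriv (n - 1) (c • y) = c • iteratedDeriv (n - 1) y := by
    ext t; exact iteratedDeriv_const_smul hy.2.1.contDiffAt c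
  have e2 : iteratedDeriv n (c • y) x = c * iteratedDeriv n y x := by
    rw [iteratedDeriv_eq_deriv hn, iteratedDeriv_eq_deriv hn, e1, (hux.const_smul c).deriv,
      hux.deriv, smul_eq_mul]
  have dz : Differentiable ℝ fun t => starRingEnd ℂ (z t) :=
    (Complex.conjCLE.contDiff.comp (contDiff_one hn hz)).differentiable (by norm_num)
  have dy : Differentiable ℝ y := (contDiff_one hn hy).differentiable (by norm_num)
  have e3 : deriv (fun t => (c • y) t * starRingEnd ℂ (z t)) x =
      c * deriv (fun t => y t * starRingEnd ℂ (z t)) x := by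
    have h := ((dy x).hasDerivAt.fun_mul (dz x).hasDerivAt).const_mul c
    rw [((dy x).hasDerivAt.fun_mul (dz x).hasDerivAt).deriv, ← h.deriv]
    congr 1; ext t; simp [mul_assoc]
  simp only [e2, e3]; ring

end helpers

/-- The kernel of the pencil at `λ`: the weak solutions `y` of
`(-1)^n y^{(2n)} - λ ρ y = 0`, `y^{(k)}(0) = y^{(k)}(1) = 0` for `0 ≤ k < n`, where `ρ = P'`.
The number `λ` is an eigenvalue when this space is nonzero, and its multiplicity is the
dimension of this space. -/
noncomputable def eigenspace {n : ℕ} (hn : 1 < n) (P : L2) (lam : ℂ) :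
    Submodule ℂ (ℝ → ℂ) where
  carrier := {y | y ∈ sobolevZero n ∧ ∀ z ∈ sobolevZero n, pencilForm n P lam y z = 0}
  zero_mem' := by
    refine ⟨zero_mem _, fun z hz => ?_⟩
    have h := pencilForm_smul (P := P) (lam := lam) hn 0 (zero_mem (sobolevZero n)) hz
    simpa using h
  add_mem' := by
    rintro y w ⟨hy, hy'⟩ ⟨hw, hw'⟩
    exact ⟨add_mem hy hw, fun z hz => by
      rw [pencilForm_add hn hy hw hz, hy' z hz, hw' z hz, add_zero]⟩
  smul_mem' := by
    rintro c y ⟨hy, hy'⟩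
    exact ⟨Submodule.smul_mem _ c hy, fun z hz => by
      rw [pencilForm_smul hn c hy hz, hy' z hz, mul_zero]⟩

/-- The infinite sequence `ev 1, ev 2, …` lists the negative eigenvalues `λ_{-1}, λ_{-2}, …` of
the boundary value problem in decreasing order, each repeated according to its (finite)
multiplicity. The term `ev 0` plays no role. -/
structure IsNegEigenvalueSeq {n : ℕ} (hn : 1 < n) (P : L2) (ev : ℕ → ℝ) : Prop where
  neg : ∀ k, 1 ≤ k → ev k < 0
  decreasing : ∀ j k, 1 ≤ j → j ≤ k → ev k ≤ ev j
  finite : ∀ x : ℝ, x < 0 → FiniteDimensional ℂ (eigenspace hn P (x : ℂ))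
  multiplicity : ∀ x : ℝ, x < 0 →
    {k : ℕ | 1 ≤ k ∧ ev k = x}.encard = (Module.finrank ℂ (eigenspace hn P (x : ℂ)) : ℕ∞)

end SelfSimilarSpectrum

/-! On the `m`-th piece of the partition `P` is an affine image of a scaled copy of itself, and on
every other piece it is constant. Tested against functions vanishing at 0 and 1, ρ = P' is therefore
a sum of atoms: masses ζ_i at the inner nodes α_i, plus d_m times the image of ρ under the
similarity S of [0, 1] onto the `m`-th piece. Generation j of the atoms carries the masses d_m^j ζ_i
at S^j(α_i) (`massForm_eq`, `massForm_eq_iterate`), and d_m > 0 keeps the signs.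

In the Hilbert space with norm ‖y⁽ⁿ⁾‖ the form ∫ρ|y|² belongs to a compact self-adjoint operator A,
and the pencil at λ becomes I - λA (`pencilForm_rep`). Hence -x < 0 is an eigenvalue exactly when
-1/x is an eigenvalue of A, with the same multiplicity. The number N(T) of such x ≤ T, counted with
multiplicity, is the largest dimension of a subspace on which ⟨Ay, y⟩ ≤ -‖y‖²/T.

Put q = a_m^(2n-1) d_m < 1 and Z = Z_-. Two estimates of N carry the theorem.

Squeezing a function into the `m`-th piece multiplies ‖y‖² by a_m^-(2n-1) and the form by d_m. To a
squeezed negative subspace one can add Z bumps, one at each negative atom of the first generation;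
they do not interact with the squeezed functions, which vanish at the nodes. This gives N(T) + Z ≤
N(T/q + C) (`exists_negative_subspace_step`), that is, s_(k+Z) ≤ s_k/q + C for the ordered
characteristic numbers s_k. With K chosen so that C + K = K/q, the sequence (s_(l+kZ) + K) q^k
decreases, so s_(l+kZ) q^k converges.

The limit is positive because N cannot grow faster: kZ evaluations at the negative atoms of the
first k generations, together with n conditions at one point, force ⟨Ay, y⟩ ≥ -C₀ q^k ‖y‖²
(`massOp_lower_bound`). A bounded excess of codimension is harmless, since only positivity is at
stake. No two-sided comparison of N(T) and N(T/q) is needed. -/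

namespace SelfSimilarSpectrum

open MeasureTheory Set Filter Topology

/-! ### Counting functions and geometric sequences -/

section Enumeration

/-- A locally finite multiplicity function on `ℝ` that is supported on a set bounded below locally
and has infinite total mass can be enumerated in increasing order. -/
theorem exists_enumeration {mult N : ℝ → ℕ} (hfin : ∀ T, {x | x ≤ T ∧ mult x ≠ 0}.Finite)
    (hN : ∀ T, N T = ∑ x ∈ (hfin T).toFinset, mult x) (hunb : ∀ k, ∃ T, k ≤ N T) :
    ∃ s : ℕ → ℝ, (∀ k, 1 ≤ k → mult (s k) ≠ 0) ∧ (∀ k, 1 ≤ k → ∀ T, s k ≤ T ↔ k ≤ N T) ∧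
      ∀ x, {k | 1 ≤ k ∧ s k = x}.encard = mult x := by
  have hmono : Monotone N := by
    intro S T hST
    rw [hN, hN]
    refine Finset.sum_le_sum_of_subset ?_
    intro x hx
    simp only [Finite.mem_toFinset, mem_ofPred_eq] at hx ⊢
    exact ⟨hx.1.trans hST, hx.2⟩
  have key : ∀ k, 1 ≤ k → ∃ v, mult v ≠ 0 ∧ ∀ T, v ≤ T ↔ k ≤ N T := by
    intro k hk
    obtain ⟨T₀, hT₀⟩ := hunb k
    -- `N` changes only at support points, so the level `k` is already reached at the largest
    -- support point not exceeding `T`.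
    have attained : ∀ T, k ≤ N T → ∃ v, v ≤ T ∧ mult v ≠ 0 ∧ k ≤ N v := by
      intro T hT
      have hne : (hfin T).toFinset.Nonempty := by
        by_contra h
        rw [Finset.not_nonempty_iff_eq_empty] at h
        rw [hN, h, Finset.sum_empty] at hT
        omega
      have hmem := Finset.max'_mem _ hne
      set v := (hfin T).toFinset.max' hne with hv
      have hmem' : v ≤ T ∧ mult v ≠ 0 := by simpa using hmem
      refine ⟨v, hmem'.1, hmem'.2, hT.trans ?_⟩
      rw [hN, hN]
      refine Finset.sum_le_sum_of_subset ?_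
      intro x hx
      have hx' := Finset.le_max' _ _ hx
      simp only [Finite.mem_toFinset, mem_ofPred_eq] at hx ⊢
      exact ⟨hx', hx.2⟩
    -- `s k` will be the least support point where `N` reaches `k`; cutting off at `T₀` leaves
    -- finitely many candidates.
    have hF : {x | (x ≤ T₀ ∧ mult x ≠ 0) ∧ k ≤ N x}.Finite := (hfin T₀).subset fun x hx => hx.1
    have hne : hF.toFinset.Nonempty := by
      obtain ⟨v, h1, h2, h3⟩ := attained T₀ hT₀
      exact ⟨v, by simpa using ⟨⟨h1, h2⟩, h3⟩⟩
    have hmem := Finset.min'_mem _ hne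
    set v := hF.toFinset.min' hne with hv
    have hmem' : (v ≤ T₀ ∧ mult v ≠ 0) ∧ k ≤ N v := by simpa using hmem
    refine ⟨v, hmem'.1.2, fun T => ⟨fun h => hmem'.2.trans (hmono h), fun h => ?_⟩⟩
    obtain ⟨w, h1, h2, h3⟩ := attained T h
    rcases le_total w T₀ with hw | hw
    · exact (Finset.min'_le _ w (by simpa using ⟨⟨hw, h2⟩, h3⟩)).trans h1
    · exact hmem'.1.1.trans (hw.trans h1)
  choose! s hs1 hs2 using key
  refine ⟨s, hs1, hs2, fun x => ?_⟩
  -- `M` is the total multiplicity strictly below `x`, so `s k = x` holds exactly for `M < k ≤ M +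
  -- mult x`.
  set M := ∑ y ∈ (hfin x).toFinset.erase x, mult y with hM
  have hNx : N x = M + mult x := by
    rw [hN, hM]
    by_cases hx : x ∈ (hfin x).toFinset
    · rw [Finset.sum_erase_add _ _ hx]
    · have : mult x = 0 := by simpa using hx
      rw [Finset.erase_eq_of_notMem hx, this, add_zero]
  have hlt : ∀ k, 1 ≤ k → (s k < x ↔ k ≤ M) := by
    intro k hk
    constructor
    · intro h
      refine ((hs2 k hk _).1 le_rfl).trans ?_
      rw [hN]
      refine Finset.sum_le_sum_of_subset ?_
      intro y hy
      simp only [Finite.mem_toFinset, mem_ofPred_eq, Finset.mem_erase] at hy ⊢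
      exact ⟨(hy.1.trans_lt h).ne, hy.1.trans h.le, hy.2⟩
    · intro h
      have hne : ((hfin x).toFinset.erase x).Nonempty := by
        by_contra h'
        rw [Finset.not_nonempty_iff_eq_empty] at h'
        rw [hM, h', Finset.sum_empty] at h
        omega
      have hmem := Finset.max'_mem _ hne
      set v := ((hfin x).toFinset.erase x).max' hne with hv
      have hmem' : v ≠ x ∧ v ≤ x ∧ mult v ≠ 0 := by simpa using hmem
      refine lt_of_le_of_lt ((hs2 k hk v).2 (h.trans ?_)) (lt_of_le_of_ne hmem'.2.1 hmem'.1)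
      rw [hM, hN]
      refine Finset.sum_le_sum_of_subset ?_
      intro y hy
      have hy' := Finset.le_max' _ _ hy
      simp only [Finite.mem_toFinset, mem_ofPred_eq, Finset.mem_erase] at hy ⊢
      exact ⟨hy', hy.2.2⟩
  have hset : {k | 1 ≤ k ∧ s k = x} = ((Finset.Ioc M (M + mult x) : Finset ℕ) : Set ℕ) := by
    ext k
    simp only [mem_ofPred_eq, Finset.coe_Ioc, mem_Ioc]
    constructor
    · rintro ⟨hk, rfl⟩
      refine ⟨?_, ?_⟩
      · by_contra h
        exact lt_irrefl _ ((hlt k hk).2 (not_lt.1 h))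
      · rw [← hNx]
        exact (hs2 k hk _).1 le_rfl
    · rintro ⟨h1, h2⟩
      have hk : 1 ≤ k := by omega
      refine ⟨hk, le_antisymm ((hs2 k hk x).2 (hNx ▸ h2)) ?_⟩
      by_contra h
      have := (hlt k hk).1 (not_le.1 h)
      omega
  rw [hset, encard_coe_eq_coe_finsetCard, Nat.card_Ioc]
  simp

/-- A positive sequence that grows at most like `μ (j + Z) ≤ μ j / q + C` and at least
geometrically has exact geometric asymptotics along each residue class modulo `Z`. -/
theorem exists_geometric_limit {q C c₀ : ℝ} {Z k₀ : ℕ} {s : ℕ → ℝ} (hq : 0 < q) (hq1 : q < 1)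
    (hC : 0 < C) (hc₀ : 0 < c₀) (l : ℕ)
    (hup : ∀ k, s (l + (k + 1) * Z) ≤ s (l + k * Z) / q + C)
    (hlow : ∀ k, c₀ * (q ^ k)⁻¹ ≤ s (l + (k + k₀) * Z)) :
    ∃ τ : ℝ, 0 < τ ∧ Tendsto (fun k : ℕ => s (l + k * Z) * q ^ k) atTop (𝓝 τ) := by
  -- `K` solves C + K = K/q. Adding it absorbs the constant `C` and turns the growth bound into
  -- monotonicity of (s + K) q^k.
  set K := C * q / (1 - q) with hK
  have h1q : 0 < 1 - q := by linarith
  have hKpos : 0 < K := by positivity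
  have hKeq : C + K = K / q := by
    rw [hK]; field_simp; ring
  set x : ℕ → ℝ := fun k => (s (l + k * Z) + K) * q ^ k with hx
  have hanti : Antitone x := by
    refine antitone_nat_of_succ_le fun k => ?_
    have h : s (l + (k + 1) * Z) + K ≤ (s (l + k * Z) + K) / q := by
      rw [add_div, ← hKeq]
      linarith [hup k]
    calc x (k + 1) ≤ (s (l + k * Z) + K) / q * q ^ (k + 1) :=
          mul_le_mul_of_nonneg_right h (by positivity)
      _ = x k := by
          rw [hx]; field_simp; ring
  have hxlow : ∀ k, c₀ * q ^ k₀ ≤ x k := by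
    intro k
    refine le_trans ?_ (hanti (Nat.le_add_right k k₀))
    have h := hlow k
    have h2 : c₀ * (q ^ k)⁻¹ * q ^ (k + k₀) ≤ x (k + k₀) :=
      mul_le_mul_of_nonneg_right (by linarith) (by positivity)
    have h3 : c₀ * (q ^ k)⁻¹ * q ^ (k + k₀) = c₀ * q ^ k₀ := by
      rw [pow_add]; field_simp
    linarith
  have hbdd : BddBelow (range x) := ⟨c₀ * q ^ k₀, by rintro _ ⟨k, rfl⟩; exact hxlow k⟩
  have hlim := tendsto_atTop_ciInf hanti hbdd
  refine ⟨⨅ i, x i, lt_of_lt_of_le (by positivity) (le_ciInf hxlow), ?_⟩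
  have h0 : Tendsto (fun k : ℕ => K * q ^ k) atTop (𝓝 0) := by
    simpa using (tendsto_pow_atTop_nhds_zero_of_lt_one hq.le hq1).const_mul K
  have := hlim.sub h0
  rw [sub_zero] at this
  refine this.congr fun k => ?_
  rw [hx]; ring

end Enumeration

/-! ### Quadratic form of a compact self-adjoint operator and its negative eigenspaces -/

section Spectral

variable {H : Type*} [NormedAddCommGroup H] [InnerProductSpace ℂ H]

local notation "⟪" x "," y "⟫" => inner ℂ x y

theorem finrank_finsetSup {ι : Type*} {p : ι → Submodule ℂ H}
    (hfd : ∀ i, FiniteDimensional ℂ (p i)) {s : Finset ι} (hs : s.SupIndep p) :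
    Module.finrank ℂ (s.sup p : Submodule ℂ H) = ∑ i ∈ s, Module.finrank ℂ (p i) := by
  classical
  induction s using Finset.induction_on with
  | empty => simp
  | insert i s his ih =>
    rw [Finset.sum_insert his, ← ih (hs.subset (Finset.subset_insert _ _)), Finset.sup_insert]
    have hdisj : Disjoint (p i) (s.sup p) :=
      hs (Finset.subset_insert _ _) (Finset.mem_insert_self _ _) his
    have := Submodule.finrank_sup_add_finrank_inf_eq (p i) (s.sup p)
    rw [hdisj.eq_bot, finrank_bot, add_zero] at this
    exact this

/-- The eigenspace of `A` for the eigenvalue `-1/x`. -/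
noncomputable def negEigenspace (A : H →L[ℂ] H) (x : ℝ) : Submodule ℂ H :=
  Module.End.eigenspace (A : Module.End ℂ H) ((-x⁻¹ : ℝ) : ℂ)

variable {A : H →L[ℂ] H}

theorem apply_of_mem_negEigenspace {x : ℝ} {y : H} (hy : y ∈ negEigenspace A x) :
    A y = ((-x⁻¹ : ℝ) : ℂ) • y := Module.End.mem_eigenspace_iff.1 hy

theorem orthogonalFamily_negEigenspace (hA : (A : H →ₗ[ℂ] H).IsSymmetric) :
    OrthogonalFamily ℂ (fun x : ℝ => negEigenspace A x)
      fun x => (negEigenspace A x).subtypeₗᵢ := by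
  refine hA.orthogonalFamily_eigenspaces.comp (γ := ℝ) (f := fun x : ℝ => ((-x⁻¹ : ℝ) : ℂ)) ?_
  intro x y h
  simpa using h

theorem re_inner_le_of_mem_sup (hA : (A : H →ₗ[ℂ] H).IsSymmetric) {T : ℝ} {s : Finset ℝ}
    (hs : ∀ x ∈ s, 0 < x ∧ x ≤ T) {y : H} (hy : y ∈ s.sup (negEigenspace A)) :
    (⟪A y, y⟫).re ≤ -T⁻¹ * ‖y‖ ^ 2 := by
  classical
  rw [Finset.sup_eq_iSup, Submodule.mem_iSup_finset_iff_exists_sum] at hy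
  obtain ⟨f, rfl⟩ := hy
  have hV := orthogonalFamily_negEigenspace hA
  have h1 : A (∑ i ∈ s, (f i : H)) =
      ∑ i ∈ s, (negEigenspace A i).subtypeₗᵢ (((-i⁻¹ : ℝ) : ℂ) • f i) := by
    rw [map_sum]
    refine Finset.sum_congr rfl fun i _ => ?_
    rw [apply_of_mem_negEigenspace (f i).2]
    simp
  have h2 : ⟪A (∑ i ∈ s, (f i : H)), ∑ i ∈ s, (f i : H)⟫ =
      ∑ i ∈ s, ⟪((-i⁻¹ : ℝ) : ℂ) • f i, f i⟫ := by
    rw [h1]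
    exact hV.inner_sum (fun i => ((-i⁻¹ : ℝ) : ℂ) • f i) f s
  have h3 : ‖∑ i ∈ s, (f i : H)‖ ^ 2 = ∑ i ∈ s, ‖f i‖ ^ 2 := hV.norm_sum f s
  rw [h2, h3, Complex.re_sum, Finset.mul_sum]
  refine Finset.sum_le_sum fun i hi => ?_
  obtain ⟨hi0, hiT⟩ := hs i hi
  rw [inner_smul_left, inner_self_eq_norm_sq_to_K]
  have : ((starRingEnd ℂ) ((-i⁻¹ : ℝ) : ℂ) * ((‖f i‖ : ℂ)) ^ 2).re = -i⁻¹ * ‖f i‖ ^ 2 := by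
    rw [Complex.conj_ofReal, ← Complex.ofReal_pow, ← Complex.ofReal_mul, Complex.ofReal_re]
  refine this.le.trans ?_
  exact mul_le_mul_of_nonneg_right (neg_le_neg (inv_anti₀ hi0 hiT)) (by positivity)

variable [CompleteSpace H]

/-- Expand `y` along all eigenspaces of `A`. Orthogonality kills the components with eigenvalue at
most -1/T, so each surviving component contributes more than -1/T times its squared norm, and at
least one is nonzero. The strictness is what makes the dimension count for `N T` exact. -/
theorem lt_re_inner_of_orthogonal (hc : IsCompactOperator A) (hA : (A : H →ₗ[ℂ] H).IsSymmetric)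
    {T : ℝ} (hT : 0 < T) {y : H} (hy0 : y ≠ 0)
    (hy : ∀ x, 0 < x → x ≤ T → ∀ w ∈ negEigenspace A x, ⟪w, y⟫ = 0) :
    -T⁻¹ * ‖y‖ ^ 2 < (⟪A y, y⟫).re := by
  classical
  have htop : ⊤ ≤ (⨆ μ, Module.End.eigenspace (A : Module.End ℂ H) μ).topologicalClosure := by
    rw [← Submodule.orthogonal_orthogonal_eq_closure,
      ContinuousLinearMap.orthogonalComplement_iSup_eigenspaces_eq_bot hc hA,
      Submodule.bot_orthogonal_eq_top]
  have hfam := hA.orthogonalFamily_eigenspaces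
  have hcl : ∀ μ, CompleteSpace (Module.End.eigenspace (A : Module.End ℂ H) μ) := fun μ => by
    have : IsClosed ((Module.End.eigenspace (A : Module.End ℂ H) μ : Submodule ℂ H) : Set H) := by
      have h : ((Module.End.eigenspace (A : Module.End ℂ H) μ : Submodule ℂ H) : Set H) =
          {v | A v = μ • v} := by
        ext v; exact Module.End.mem_eigenspace_iff
      rw [h]
      exact isClosed_eq A.continuous (continuous_const_smul μ)
    exact this.completeSpace_coe
  have hsum : IsHilbertSum ℂ (fun μ => Module.End.eigenspace (A : Module.End ℂ H) μ)
      fun μ => (Module.End.eigenspace (A : Module.End ℂ H) μ).subtypeₗᵢ :=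
    IsHilbertSum.mkInternal (F := fun μ => Module.End.eigenspace (A : Module.End ℂ H) μ) hfam htop
  obtain ⟨f, hf⟩ := hsum.surjective_isometry y
  have hS : HasSum (fun μ => (f μ : H)) y := by
    rw [← hf]; exact hsum.OrthogonalFamily.hasSum_linearIsometry f
  have hin : ∀ μ, ⟪(f μ : H), y⟫ = ((‖f μ‖ ^ 2 : ℝ) : ℂ) := by
    intro μ
    have h1 : HasSum (fun ν => ⟪(f μ : H), (f ν : H)⟫) ⟪(f μ : H), y⟫ :=
      (innerSL ℂ (f μ : H)).hasSum hS
    have h2 : HasSum (fun ν => ⟪(f μ : H), (f ν : H)⟫) ⟪(f μ : H), (f μ : H)⟫ := by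
      refine hasSum_single μ fun ν hν => ?_
      exact hfam hν.symm (f μ) (f ν)
    rw [h1.unique h2, inner_self_eq_norm_sq_to_K]
    push_cast; rfl
  have hAf : ∀ μ, A (f μ : H) = μ • (f μ : H) := fun μ => Module.End.mem_eigenspace_iff.1 (f μ).2
  have hS1 : HasSum (fun μ => (‖f μ‖ ^ 2 : ℝ)) (‖y‖ ^ 2) := by
    have h1 : HasSum (fun μ => ⟪y, (f μ : H)⟫) ⟪y, y⟫ := (innerSL ℂ y).hasSum hS
    have h2 := Complex.hasSum_re h1
    rw [inner_self_eq_norm_sq_to_K] at h2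
    convert h2 using 1
    · funext μ
      rw [← inner_conj_symm, hin μ, Complex.conj_ofReal, Complex.ofReal_re]
    · norm_cast
  have hS2 : HasSum (fun μ : ℂ => μ.re * ‖f μ‖ ^ 2) (⟪A y, y⟫).re := by
    have h1 : HasSum (fun μ => ⟪y, A (f μ : H)⟫) ⟪y, A y⟫ :=
      (innerSL ℂ y).hasSum (A.hasSum hS)
    have h2 := Complex.hasSum_re h1
    have h3 : (⟪y, A y⟫).re = (⟪A y, y⟫).re := by
      rw [← inner_conj_symm, Complex.conj_re]
    rw [h3] at h2
    convert h2 using 1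
    funext μ
    rw [hAf, inner_smul_right, ← inner_conj_symm, hin μ, Complex.conj_ofReal, Complex.re_mul_ofReal]
  have hS3 : HasSum (fun μ : ℂ => (μ.re + T⁻¹) * ‖f μ‖ ^ 2) ((⟪A y, y⟫).re + T⁻¹ * ‖y‖ ^ 2) := by
    convert hS2.add (hS1.mul_left T⁻¹) using 1
    funext μ; ring
  -- An eigenvalue μ ≤ -1/T is -1/x for x = (-μ)⁻¹ ≤ T, so its component is orthogonal to `y` by
  -- hypothesis and hence zero.
  have hreal : ∀ μ : ℂ, f μ ≠ 0 → ((μ.re : ℝ) : ℂ) = μ ∧ -T⁻¹ < μ.re := by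
    intro μ hμ
    have hev : Module.End.HasEigenvalue (A : Module.End ℂ H) μ := by
      rw [Module.End.hasEigenvalue_iff]
      intro hbot
      apply hμ
      exact Subtype.ext ((Submodule.eq_bot_iff _).1 hbot _ (f μ).2)
    have h1 := hA.conj_eigenvalue_eq_self hev
    have h2 : ((μ.re : ℝ) : ℂ) = μ := Complex.conj_eq_iff_re.1 h1
    refine ⟨h2, ?_⟩
    by_contra hle
    push Not at hle
    apply hμ
    have hneg : μ.re < 0 := lt_of_le_of_lt hle (by simpa using hT)
    have hmem : (f μ : H) ∈ negEigenspace A (-μ.re)⁻¹ := by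
      unfold negEigenspace
      rw [inv_inv, neg_neg, h2]
      exact (f μ).2
    have h3 := hy (-μ.re)⁻¹ (by simpa using hneg)
      (by rw [inv_le_comm₀ (by linarith) hT]; linarith) _ hmem
    rw [hin μ] at h3
    have h4 : ‖f μ‖ ^ 2 = 0 := by exact_mod_cast h3
    simpa using h4
  have hex : ∃ μ, f μ ≠ 0 := by
    by_contra h
    push Not at h
    apply hy0
    refine hS.unique ?_
    simp [h, hasSum_zero]
  obtain ⟨μ, hμ⟩ := hex
  have hpos : 0 < (⟪A y, y⟫).re + T⁻¹ * ‖y‖ ^ 2 := by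
    refine hasSum_lt (f := 0) (i := μ) (fun ν => ?_) ?_ hasSum_zero hS3
    · rw [Pi.zero_apply]
      by_cases hν : f ν = 0
      · simp [hν]
      · have := (hreal ν hν).2
        exact mul_nonneg (by linarith) (by positivity)
    · have := (hreal μ hμ).2
      have h5 : 0 < ‖f μ‖ := norm_pos_iff.2 hμ
      exact mul_pos (by linarith) (by positivity)
  linarith

end Spectral

/-! ### Compactness criterion and spectral asymptotics from form inequalities -/

section Spectral

variable {H : Type*} [NormedAddCommGroup H] [InnerProductSpace ℂ H] [CompleteSpace H]

local notation "⟪" x "," y "⟫" => inner ℂ x y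

/-- An operator whose form is small on closed subspaces of finite codimension is compact. -/
theorem isCompactOperator_of_form_small {A : H →L[ℂ] H}
    (h : ∀ ε : ℝ, 0 < ε → ∃ (ι : Type) (_ : Fintype ι) (F : H →L[ℂ] (ι → ℂ)),
      ∀ y z, F y = 0 → F z = 0 → ‖⟪A y, z⟫‖ ≤ ε * ‖y‖ * ‖z‖) : IsCompactOperator A := by
  have hcl : A ∈ closure {f : H →L[ℂ] H | IsCompactOperator f} := by
    rw [Metric.mem_closure_iff]
    intro ε hε
    obtain ⟨ι, _, F, hF⟩ := h (ε / 2) (by positivity)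
    let M : Submodule ℂ H := LinearMap.ker (F : H →ₗ[ℂ] (ι → ℂ))
    have hMcl : IsClosed (M : Set H) := F.isClosed_ker
    have : CompleteSpace M := hMcl.completeSpace_coe
    have hfd : FiniteDimensional ℂ Mᗮ := by
      refine Module.Finite.of_injective ((F : H →ₗ[ℂ] (ι → ℂ)).domRestrict Mᗮ) ?_
      rw [← LinearMap.ker_eq_bot, LinearMap.ker_eq_bot']
      intro y hy
      have h1 : (y : H) ∈ M := hy
      have h2 := Submodule.inner_right_of_mem_orthogonal h1 y.2
      exact Subtype.ext (inner_self_eq_zero.1 h2)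
    set Q := M.starProjection with hQ
    set R := Mᗮ.starProjection with hR
    have hRc : IsCompactOperator R := by
      have : IsCompactOperator (Mᗮ.orthogonalProjectionOnto) :=
        isCompactOperator_of_locallyCompactSpace_dom (Mᗮ.orthogonalProjectionOnto)
      exact this.clm_comp (Mᗮ.subtypeL)
    have hsum : ∀ y, Q y + R y = y := fun y =>
      M.starProjection_add_starProjection_orthogonal (w := y)
    -- `R` has finite rank, because `F` is injective on the orthogonal complement of its kernel.
    -- Subtracting the compact operator RA + QAR from A leaves QAQ, whose norm is governed by the
    -- form on ker `F`.
    refine ⟨R ∘L A + Q ∘L A ∘L R, ?_, ?_⟩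
    · have h1 : IsCompactOperator (R ∘L A) := hRc.comp_clm A
      have h2 : IsCompactOperator (Q ∘L A ∘L R) := hRc.clm_comp (Q ∘L A)
      exact h1.add h2
    · rw [dist_eq_norm]
      refine lt_of_le_of_lt (ContinuousLinearMap.opNorm_le_bound _ (by positivity : 0 ≤ ε / 2)
        fun y => ?_) (half_lt_self hε)
      have heq : (A - (R ∘L A + Q ∘L A ∘L R)) y = Q (A (Q y)) := by
        have h1 := hsum (A y)
        have h2 : A y = A (Q y) + A (R y) := by rw [← map_add, hsum]
        have h3 : Q (A y) = Q (A (Q y)) + Q (A (R y)) := by rw [← map_add, ← h2]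
        simp only [sub_apply, add_apply, ContinuousLinearMap.comp_apply]
        rw [sub_eq_iff_eq_add, ← add_assoc, add_comm (Q _) (R _), add_assoc, ← h3, add_comm, h1]
      rw [heq]
      have hmem : ∀ w, Q w ∈ M := fun w => Submodule.starProjection_apply_mem M w
      have h1 := hF (Q y) (Q (A (Q y))) (hmem y) (hmem _)
      have h2 : ⟪A (Q y), Q (A (Q y))⟫ = ⟪Q (A (Q y)), Q (A (Q y))⟫ := by
        rw [← sub_eq_zero, ← inner_sub_left]
        exact M.starProjection_inner_eq_zero _ _ (hmem _)
      rw [h2, inner_self_eq_norm_sq_to_K] at h1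
      have h3 : ‖Q y‖ ≤ ‖y‖ := M.norm_starProjection_apply_le y
      have h4 : ‖Q (A (Q y))‖ ^ 2 ≤ ε / 2 * ‖Q y‖ * ‖Q (A (Q y))‖ := by
        simpa using h1
      rcases (norm_nonneg (Q (A (Q y)))).eq_or_lt with h0 | h0
      · rw [← h0]; positivity
      · have : ‖Q (A (Q y))‖ ≤ ε / 2 * ‖Q y‖ := by nlinarith
        exact this.trans (by gcongr)
  rwa [isClosed_setOfPred_isCompactOperator.closure_eq] at hcl

/-- The asymptotics of the negative characteristic numbers of a compact self-adjoint operator that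
is self-similar in the sense of the form inequalities `hstep` and `hcodim`. -/
theorem exists_negative_spectrum_asymptotics {A : H →L[ℂ] H} (hc : IsCompactOperator A)
    (hA : (A : H →ₗ[ℂ] H).IsSymmetric) {q C C₀ : ℝ} {Z c : ℕ} (hq : 0 < q) (hq1 : q < 1)
    (hZ : 0 < Z) (hC : 0 < C) (hC₀ : 0 < C₀)
    (hstep : ∀ L : Submodule ℂ H, FiniteDimensional ℂ L → ∀ T : ℝ, 0 < T →
      (∀ y ∈ L, (⟪A y, y⟫).re ≤ -T⁻¹ * ‖y‖ ^ 2) → ∃ L' : Submodule ℂ H,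
        FiniteDimensional ℂ L' ∧ Module.finrank ℂ L' = Module.finrank ℂ L + Z ∧
        ∀ y ∈ L', (⟪A y, y⟫).re ≤ -(T / q + C)⁻¹ * ‖y‖ ^ 2)
    (hcodim : ∀ k : ℕ, ∃ (ι : Type) (_ : Fintype ι) (F : H →ₗ[ℂ] (ι → ℂ)),
      Fintype.card ι ≤ k * Z + c ∧ ∀ y, F y = 0 → -(C₀ * q ^ k) * ‖y‖ ^ 2 ≤ (⟪A y, y⟫).re) :
    ∃ s : ℕ → ℝ, (∀ k, 1 ≤ k → 0 < s k) ∧ (∀ j k, 1 ≤ j → j ≤ k → s j ≤ s k) ∧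
      (∀ x, 0 < x → FiniteDimensional ℂ (negEigenspace A x) ∧
        {k | 1 ≤ k ∧ s k = x}.encard = Module.finrank ℂ (negEigenspace A x)) ∧
      ∀ l, 1 ≤ l → ∃ τ : ℝ, 0 < τ ∧
        Tendsto (fun k : ℕ => s (l + k * Z) * q ^ k) atTop (𝓝 τ) := by
  classical
  have hfd : ∀ x, 0 < x → FiniteDimensional ℂ (negEigenspace A x) := fun x hx =>
    ContinuousLinearMap.finite_dimensional_eigenspace hc _
      (by exact_mod_cast (neg_ne_zero.2 (inv_ne_zero hx.ne')))
  -- The cut-off at 0 matters: for x < 0 `negEigenspace` belongs to a positive eigenvalue, and at x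
  -- = 0 the convention 0⁻¹ = 0 makes it the kernel of `A`.
  let G : ℝ → Submodule ℂ H := fun x => if 0 < x then negEigenspace A x else ⊥
  have hG : ∀ x, 0 < x → G x = negEigenspace A x := fun x hx => if_pos hx
  have hGfd : ∀ x, FiniteDimensional ℂ (G x) := by
    intro x
    by_cases hx : 0 < x
    · rw [hG x hx]; exact hfd x hx
    · have : G x = ⊥ := if_neg hx
      rw [this]; infer_instance
  have hind : iSupIndep (negEigenspace A) := (orthogonalFamily_negEigenspace hA).independent
  have hGind : iSupIndep G := by
    refine hind.mono fun x => ?_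
    by_cases hx : 0 < x
    · rw [hG x hx]
    · have : G x = ⊥ := if_neg hx
      rw [this]; exact bot_le
  have hsupind : ∀ s : Finset ℝ, s.SupIndep G := fun s =>
    iSupIndep.supIndep (hGind.comp Subtype.val_injective)
  let mult : ℝ → ℕ := fun x => Module.finrank ℂ (G x)
  have hmult0 : ∀ x, mult x ≠ 0 → 0 < x := by
    intro x hx
    by_contra h
    apply hx
    have : G x = ⊥ := if_neg h
    simp [mult, this]
  have hnegsup : ∀ (T : ℝ) (s : Finset ℝ), (∀ x ∈ s, x ≤ T ∧ mult x ≠ 0) → ∀ y ∈ s.sup G,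
      (⟪A y, y⟫).re ≤ -T⁻¹ * ‖y‖ ^ 2 := by
    intro T s hs y hy
    refine re_inner_le_of_mem_sup hA (s := s) (fun x hx => ⟨hmult0 x (hs x hx).2, (hs x hx).1⟩) ?_
    have : s.sup G = s.sup (negEigenspace A) :=
      Finset.sup_congr rfl fun x hx => hG x (hmult0 x (hs x hx).2)
    rwa [← this]
  -- A nonzero vector of the span killed by `F` would satisfy -C₀ q^k ‖y‖² ≤ ⟨Ay, y⟩ ≤ -‖y‖²/T,
  -- which is impossible for C₀ q^k < 1/T. So `F` is injective on the span.
  have hcount : ∀ (k : ℕ) (T : ℝ), 0 < T → C₀ * q ^ k < T⁻¹ → ∀ s : Finset ℝ,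
      (∀ x ∈ s, x ≤ T ∧ mult x ≠ 0) → ∑ x ∈ s, mult x ≤ k * Z + c := by
    intro k T hT hkT s hs
    obtain ⟨ι, _, F, hcard, hF⟩ := hcodim k
    rw [← finrank_finsetSup hGfd (hsupind s)]
    refine le_trans ?_ hcard
    rw [← Module.finrank_pi (R := ℂ) (ι := ι)]
    refine LinearMap.finrank_le_finrank_of_injective (f := F.domRestrict (s.sup G)) ?_
    rw [← LinearMap.ker_eq_bot, LinearMap.ker_eq_bot']
    intro y hy
    have h1 := hF y hy
    have h2 := hnegsup T s hs y y.2
    by_contra hne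
    have h3 : 0 < ‖(y : H)‖ := norm_pos_iff.2 fun h => hne (Subtype.ext h)
    nlinarith [pow_pos h3 2]
  have hqk : ∀ T : ℝ, 0 < T → ∃ k : ℕ, C₀ * q ^ k < T⁻¹ := by
    intro T hT
    obtain ⟨k, hk⟩ := exists_pow_lt_of_lt_one (show 0 < T⁻¹ / C₀ by positivity) hq1
    exact ⟨k, by rw [lt_div_iff₀ hC₀] at hk; linarith⟩
  have hfin : ∀ T, {x | x ≤ T ∧ mult x ≠ 0}.Finite := by
    intro T
    by_cases hT : 0 < T
    · obtain ⟨k, hk⟩ := hqk T hT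
      by_contra hinf
      obtain ⟨t, ht, hcard⟩ := Set.Infinite.exists_subset_card_eq hinf (k * Z + c + 1)
      have h1 := hcount k T hT hk t fun x hx => ht hx
      have h2 : ∑ x ∈ t, 1 ≤ ∑ x ∈ t, mult x :=
        Finset.sum_le_sum fun x hx => Nat.one_le_iff_ne_zero.2 (ht hx).2
      simp at h2
      omega
    · convert Set.finite_empty (α := ℝ)
      ext x
      simp only [mem_ofPred_eq, mem_empty_iff_false, iff_false, not_and, not_not]
      intro hx
      by_contra h
      exact hT ((hmult0 x h).trans_le hx)
  let N : ℝ → ℕ := fun T => ∑ x ∈ (hfin T).toFinset, mult x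
  have hmemT : ∀ T, ∀ x ∈ (hfin T).toFinset, x ≤ T ∧ mult x ≠ 0 := fun T x hx => by
    simpa using hx
  let E : ℝ → Submodule ℂ H := fun T => (hfin T).toFinset.sup G
  have hEfd : ∀ T, FiniteDimensional ℂ (E T) := fun T => by
    have : ∀ s : Finset ℝ, FiniteDimensional ℂ (s.sup G : Submodule ℂ H) := fun s =>
      Submodule.finiteDimensional_finset_sup s G
    exact this _
  have hEN : ∀ T, Module.finrank ℂ (E T) = N T := fun T => finrank_finsetSup hGfd (hsupind _)
  -- The orthogonal projection to `E T` is injective on `L`: a nonzero vector of `L` orthogonal to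
  -- `E T` would contradict `lt_re_inner_of_orthogonal`.
  have hmax : ∀ (L : Submodule ℂ H), FiniteDimensional ℂ L → ∀ T, 0 < T →
      (∀ y ∈ L, (⟪A y, y⟫).re ≤ -T⁻¹ * ‖y‖ ^ 2) → Module.finrank ℂ L ≤ N T := by
    intro L hL T hT hLT
    rw [← hEN]
    have := hEfd T
    refine LinearMap.finrank_le_finrank_of_injective
      (f := ((E T).orthogonalProjectionOnto : H →ₗ[ℂ] E T).domRestrict L) ?_
    rw [← LinearMap.ker_eq_bot, LinearMap.ker_eq_bot']
    intro y hy
    have hy' : (E T).orthogonalProjectionOnto (y : H) = 0 := hy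
    rw [Submodule.orthogonalProjectionOnto_eq_zero_iff] at hy'
    by_contra hne
    have hne' : (y : H) ≠ 0 := fun h => hne (Subtype.ext h)
    refine absurd (lt_re_inner_of_orthogonal hc hA hT hne' fun x hx hxT w hw => ?_)
      (not_lt.2 (hLT y y.2))
    by_cases hm : mult x = 0
    · have hbot : G x = ⊥ := by
        have := hGfd x
        exact Submodule.finrank_eq_zero.1 hm
      rw [← hG x hx, hbot, Submodule.mem_bot] at hw
      simp [hw]
    · refine Submodule.inner_right_of_mem_orthogonal (K := E T) ?_ hy'
      have : G x ≤ E T := Finset.le_sup (f := G) (by simpa using ⟨hxT, hm⟩)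
      exact this (by rwa [hG x hx])
  have hstepN : ∀ T, 0 < T → N T + Z ≤ N (T / q + C) := by
    intro T hT
    obtain ⟨L', h1, h2, h3⟩ := hstep (E T) (hEfd T) T hT (hnegsup T _ (hmemT T))
    rw [← hEN, ← h2]
    exact hmax L' h1 _ (by positivity) h3
  have hunb : ∀ k, ∃ T, k ≤ N T := by
    have : ∀ k : ℕ, ∃ T, 0 < T ∧ k ≤ N T := by
      intro k
      induction k with
      | zero => exact ⟨1, one_pos, Nat.zero_le _⟩
      | succ k ih =>
        obtain ⟨T, hT, hk⟩ := ih
        exact ⟨T / q + C, by positivity, by have := hstepN T hT; omega⟩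
    exact fun k => (this k).imp fun T h => h.2
  obtain ⟨s, hs1, hs2, hs3⟩ := exists_enumeration hfin (fun T => rfl : ∀ T, N T = _) hunb
  have hspos : ∀ k, 1 ≤ k → 0 < s k := fun k hk => hmult0 _ (hs1 k hk)
  refine ⟨s, hspos, ?_, ?_, ?_⟩
  · intro j k hj hjk
    rw [hs2 j hj]
    exact hjk.trans ((hs2 k (hj.trans hjk) _).1 le_rfl)
  · intro x hx
    refine ⟨hfd x hx, ?_⟩
    rw [hs3 x]
    change ((Module.finrank ℂ (G x) : ℕ) : ℕ∞) = _
    rw [hG x hx]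
  · intro l hl
    -- The shift by `c + 1` generations pushes the index past kZ + c, because Z ≥ 1; any positive
    -- `c₀` up to C₀⁻¹ would do.
    refine exists_geometric_limit (c₀ := C₀⁻¹ / 2) (k₀ := c + 1) hq hq1 hC (by positivity) l ?_ ?_
    · intro k
      have hk : 1 ≤ l + k * Z := by omega
      rw [hs2 _ (by omega)]
      have h1 := hstepN _ (hspos _ hk)
      have h2 := (hs2 _ hk _).1 le_rfl
      have h3 : l + (k + 1) * Z = l + k * Z + Z := by ring
      omega
    · intro k
      by_contra hlt
      push Not at hlt
      set x := s (l + (k + (c + 1)) * Z) with hx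
      have hidx : 1 ≤ l + (k + (c + 1)) * Z := by omega
      have hxpos : 0 < x := hspos _ hidx
      have h1 := (hs2 _ hidx x).1 le_rfl
      have h2 : C₀ * q ^ k < x⁻¹ := by
        rw [lt_inv_comm₀ (by positivity) hxpos]
        refine hlt.trans_le ?_
        rw [mul_inv]
        have : 0 < C₀⁻¹ * (q ^ k)⁻¹ := by positivity
        linarith
      have h3 : N x ≤ k * Z + c := hcount k x hxpos h2 _ (hmemT x)
      have h4 : (k + (c + 1)) * Z = k * Z + (c + 1) * Z := by ring
      have h5 : (c + 1) ≤ (c + 1) * Z := Nat.le_mul_of_pos_right _ hZ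
      omega

end Spectral

/-! ### Derivatives under affine substitution -/

section Affine

theorem iteratedDeriv_comp_affine (y : ℝ → ℂ) (p h : ℝ) (k : ℕ) :
    iteratedDeriv k (fun x => y (p + h * x)) =
      fun x => ((h ^ k : ℝ) : ℂ) * iteratedDeriv k y (p + h * x) := by
  induction k with
  | zero => ext x; simp
  | succ k ih =>
    ext x
    rw [iteratedDeriv_succ, ih, iteratedDeriv_succ, deriv_const_mul_field]
    have h1 : deriv (fun x => iteratedDeriv k y (p + h * x)) x =
        h • deriv (fun t => iteratedDeriv k y (p + t)) (h * x) :=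
      deriv_comp_mul_left h (fun t => iteratedDeriv k y (p + t)) x
    rw [h1, deriv_comp_const_add, Complex.real_smul]
    push_cast; ring

theorem norm_iteratedDeriv_comp_affine_sq (y : ℝ → ℂ) (p h : ℝ) (k : ℕ) (x : ℝ) :
    ‖iteratedDeriv k (fun x => y (p + h * x)) x‖ ^ 2 =
      h ^ (2 * k) * ‖iteratedDeriv k y (p + h * x)‖ ^ 2 := by
  rw [iteratedDeriv_comp_affine, norm_mul, mul_pow, Complex.norm_real, Real.norm_eq_abs,
    sq_abs, ← pow_mul, mul_comm k 2]

end Affine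

/-! ### The energy norm on the Sobolev space -/

section Sobolev

theorem ae_mem_Ioo_unit : ∀ᵐ x ∂unitMeasure, x ∈ Ioo (0 : ℝ) 1 := by
  rw [unitMeasure, ← Measure.restrict_congr_set Ioo_ae_eq_Icc]
  exact ae_restrict_mem measurableSet_Ioo

theorem unit_integral_eq {E : Type*} [NormedAddCommGroup E] [NormedSpace ℝ E] (f : ℝ → E) :
    ∫ x, f x ∂unitMeasure = ∫ x in (0 : ℝ)..1, f x := by
  rw [intervalIntegral.integral_of_le zero_le_one, ← integral_Icc_eq_integral_Ioc]

theorem intervalIntegrable_of_memLp {E : Type*} [NormedAddCommGroup E] {u : ℝ → E}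
    (hu : MemLp u 2 unitMeasure) {s t : ℝ} (hs : s ∈ Icc (0 : ℝ) 1) (ht : t ∈ Icc (0 : ℝ) 1) :
    IntervalIntegrable u volume s t := by
  have h : IntegrableOn u (Icc 0 1) volume := hu.integrable (by norm_num)
  rw [intervalIntegrable_iff]
  refine h.mono_set ?_
  rw [uIoc_eq_union]
  rintro x (hx | hx)
  · exact ⟨hs.1.trans hx.1.le, hx.2.trans ht.2⟩
  · exact ⟨ht.1.trans hx.1.le, hx.2.trans hs.2⟩

theorem toReal_eLpNorm_sq {u : ℝ → ℂ} (hu : MemLp u 2 unitMeasure) :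
    (eLpNorm u 2 unitMeasure).toReal ^ 2 = ∫ x in (0 : ℝ)..1, ‖u x‖ ^ 2 := by
  rw [← unit_integral_eq, ← Lp.norm_toLp u hu, ← inner_self_eq_norm_sq (𝕜 := ℂ), L2.inner_def,
    ← integral_re (L2.integrable_inner _ _)]
  refine integral_congr_ae ?_
  filter_upwards [hu.coeFn_toLp] with x hx
  rw [hx, inner_self_eq_norm_sq]

theorem norm_intervalIntegral_le {u : ℝ → ℂ} (hu : MemLp u 2 unitMeasure) {x : ℝ}
    (hx : x ∈ Icc (0 : ℝ) 1) :
    ‖∫ t in (0 : ℝ)..x, u t‖ ≤ (eLpNorm u 2 unitMeasure).toReal := by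
  have h1 : ‖∫ t in (0 : ℝ)..x, u t‖ ≤ ∫ t in (0 : ℝ)..x, ‖u t‖ :=
    intervalIntegral.norm_integral_le_integral_norm hx.1
  have h2 : ∫ t in (0 : ℝ)..x, ‖u t‖ ≤ ∫ t in (0 : ℝ)..1, ‖u t‖ := by
    refine intervalIntegral.integral_mono_interval le_rfl hx.1 hx.2
      (Eventually.of_forall fun t => norm_nonneg _) ?_
    exact (intervalIntegrable_of_memLp hu (by simp) (by simp)).norm
  have h3 : ∫ t in (0 : ℝ)..1, ‖u t‖ = (eLpNorm u 1 unitMeasure).toReal := by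
    rw [← unit_integral_eq, integral_norm_eq_lintegral_enorm hu.1, eLpNorm_one_eq_lintegral_enorm]
  have h4 : eLpNorm u 1 unitMeasure ≤ eLpNorm u 2 unitMeasure := by
    have : IsProbabilityMeasure unitMeasure := ⟨by simp [unitMeasure]⟩
    exact eLpNorm_le_eLpNorm_of_exponent_le (by norm_num) hu.1
  refine h1.trans (h2.trans (h3.le.trans ?_))
  exact ENNReal.toReal_mono hu.2.ne h4

/-- Functions that are `n`-fold integrals from `0` of their `n`-th derivative have derivatives
bounded by the energy norm. -/
theorem norm_iteratedDeriv_le {n : ℕ} {w : ℝ → ℂ} (hw : MemLp (iteratedDeriv n w) 2 unitMeasure)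
    (h : ∀ k < n, ∀ x ∈ Icc (0 : ℝ) 1, iteratedDeriv k w x =
      ∫ t in (0 : ℝ)..x, iteratedDeriv (k + 1) w t) {k : ℕ} (hk : k < n) {x : ℝ}
    (hx : x ∈ Icc (0 : ℝ) 1) :
    ‖iteratedDeriv k w x‖ ≤ (eLpNorm (iteratedDeriv n w) 2 unitMeasure).toReal := by
  -- Descending induction on the order: Cauchy–Schwarz handles order n - 1, and each further
  -- integration over a subinterval of [0, 1] does not increase the bound.
  obtain ⟨j, hj⟩ : ∃ j, n = k + 1 + j := ⟨n - (k + 1), by omega⟩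
  induction j generalizing k x with
  | zero =>
    rw [add_zero] at hj
    rw [h k hk x hx, ← hj]
    exact norm_intervalIntegral_le hw hx
  | succ j ih =>
    rw [h k hk x hx]
    have h1 : ∀ t ∈ uIoc 0 x, ‖iteratedDeriv (k + 1) w t‖ ≤
        (eLpNorm (iteratedDeriv n w) 2 unitMeasure).toReal := by
      intro t ht
      rw [uIoc_of_le hx.1] at ht
      exact ih (by omega) ⟨ht.1.le, ht.2.trans hx.2⟩ (by omega)
    refine (intervalIntegral.norm_integral_le_of_norm_le_const h1).trans ?_
    rw [sub_zero, abs_of_nonneg hx.1]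
    exact mul_le_of_le_one_right ENNReal.toReal_nonneg hx.2

variable {n : ℕ} {y z : ℝ → ℂ}

/-- Below order n - 1 this is the classical fundamental theorem of calculus. At order n - 1,
Lebesgue differentiation identifies the pointwise derivative almost everywhere with the L₂ density
from the definition of `sobolevZero`. -/
theorem iteratedDeriv_sub_eq_integral (hn : 1 < n) (hy : y ∈ sobolevZero n) {k : ℕ} (hk : k < n)
    {s t : ℝ} (hs : s ∈ Icc (0 : ℝ) 1) (ht : t ∈ Icc (0 : ℝ) 1) :
    iteratedDeriv k y t - iteratedDeriv k y s = ∫ x in s..t, iteratedDeriv (k + 1) y x := by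
  rcases Nat.lt_or_ge (k + 1) n with hk1 | hk1
  · have hc : ContDiff ℝ (k + 1 : ℕ) y := hy.2.1.of_le (by exact_mod_cast (by omega))
    rw [iteratedDeriv_succ]
    symm
    refine intervalIntegral.integral_deriv_eq_sub (fun x _ => ?_) ?_
    · exact (hc.differentiable_iteratedDeriv k (by exact_mod_cast Nat.lt_succ_self k)) x
    · rw [← iteratedDeriv_succ]
      exact (hc.continuous_iteratedDeriv (k + 1) le_rfl).intervalIntegrable _ _
  · have hkn : k = n - 1 := by omega
    subst hkn
    obtain ⟨u, hu, h⟩ := hy.2.2.1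
    obtain ⟨v, hv, hv'⟩ := ae_hasDerivAt hy
    have hu0 : ∀ x ∈ Icc (0 : ℝ) 1, IntervalIntegrable u volume 0 x := fun x hx =>
      intervalIntegrable_of_memLp hu (by simp) hx
    rw [h t ht, h s hs, intervalIntegral.integral_interval_sub_left (hu0 t ht) (hu0 s hs)]
    refine intervalIntegral.integral_congr_ae ?_
    have hI := intervalIntegrable_of_memLp hu (s := 0) (t := 1) (by simp) (by simp)
    have h1 := hI.ae_hasDerivAt_integral
    have h2 : ∀ᵐ x : ℝ, x ≠ 0 ∧ x ≠ 1 := by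
      have h0 : ∀ᵐ x : ℝ, x ≠ 0 := by simp [ae_iff]
      have h1 : ∀ᵐ x : ℝ, x ≠ 1 := by simp [ae_iff]
      exact h0.and h1
    filter_upwards [h1, h2] with x hx hx01 hxst
    have hxI : x ∈ Icc (0 : ℝ) 1 := by
      rw [uIoc_eq_union] at hxst
      rcases hxst with hx' | hx'
      · exact ⟨hs.1.trans hx'.1.le, hx'.2.trans ht.2⟩
      · exact ⟨ht.1.trans hx'.1.le, hx'.2.trans hs.2⟩
    have hxO : x ∈ Ioo (0 : ℝ) 1 :=
      ⟨lt_of_le_of_ne hxI.1 hx01.1.symm, lt_of_le_of_ne hxI.2 hx01.2⟩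
    have h3 := hx (by rw [uIcc_of_le zero_le_one]; exact hxI) 0 (by simp)
    have h4 : HasDerivAt (iteratedDeriv (n - 1) y) (u x) x := by
      refine h3.congr_of_eventuallyEq ?_
      filter_upwards [Ioo_mem_nhds hxO.1 hxO.2] with t ht
      exact h t (Ioo_subset_Icc_self ht)
    rw [iteratedDeriv_succ, h4.deriv]

theorem iteratedDeriv_eq_integral (hn : 1 < n) (hy : y ∈ sobolevZero n) {k : ℕ} (hk : k < n)
    {x : ℝ} (hx : x ∈ Icc (0 : ℝ) 1) :
    iteratedDeriv k y x = ∫ t in (0 : ℝ)..x, iteratedDeriv (k + 1) y t := by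
  rw [← iteratedDeriv_sub_eq_integral hn hy hk (by simp) hx, (hy.2.2.2 k hk).1, sub_zero]

theorem iteratedDeriv_eq_zero_of_notMem (hy : y ∈ sobolevZero n) (k : ℕ) {x : ℝ}
    (hx : x ∉ Icc (0 : ℝ) 1) : iteratedDeriv k y x = 0 := by
  have h : y =ᶠ[𝓝 x] fun _ => 0 := by
    filter_upwards [isClosed_Icc.isOpen_compl.mem_nhds hx] with t ht
    exact hy.1 t ht
  rw [h.iteratedDeriv_eq k]
  simp

theorem eval_zero (hn : 1 < n) (hy : y ∈ sobolevZero n) : y 0 = 0 := by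
  simpa using (hy.2.2.2 0 (by omega)).1

theorem eval_one (hn : 1 < n) (hy : y ∈ sobolevZero n) : y 1 = 0 := by
  simpa using (hy.2.2.2 0 (by omega)).2

/-- The map `y ↦ y⁽ⁿ⁾` from the Sobolev space to `L₂[0, 1]`. -/
noncomputable def topDeriv (hn : 1 < n) : sobolevZero n →ₗ[ℂ] Lp ℂ 2 unitMeasure where
  toFun y := (memLp_iteratedDeriv hn y.2).toLp
  map_add' y w := by
    rw [← MemLp.toLp_add]
    refine MemLp.toLp_congr _ _ ?_
    obtain ⟨u, -, hu⟩ := ae_hasDerivAt y.2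
    obtain ⟨v, -, hv⟩ := ae_hasDerivAt w.2
    filter_upwards [hu, hv] with x hux hvx
    have e1 : iteratedDeriv (n - 1) ((y + w : sobolevZero n) : ℝ → ℂ) =
        iteratedDeriv (n - 1) y + iteratedDeriv (n - 1) w := by
      ext t; exact iteratedDeriv_add y.2.2.1.contDiffAt w.2.2.1.contDiffAt
    rw [Pi.add_apply, iteratedDeriv_eq_deriv hn, iteratedDeriv_eq_deriv hn,
      iteratedDeriv_eq_deriv hn, e1, (hux.add hvx).deriv, hux.deriv, hvx.deriv]
  map_smul' c y := by
    rw [RingHom.id_apply, ← MemLp.toLp_const_smul]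
    refine MemLp.toLp_congr _ _ ?_
    obtain ⟨u, -, hu⟩ := ae_hasDerivAt y.2
    filter_upwards [hu] with x hux
    have e1 : iteratedDeriv (n - 1) ((c • y : sobolevZero n) : ℝ → ℂ) =
        c • iteratedDeriv (n - 1) y := by
      ext t; exact iteratedDeriv_const_smul y.2.2.1.contDiffAt c
    rw [Pi.smul_apply, iteratedDeriv_eq_deriv hn, iteratedDeriv_eq_deriv hn, e1,
      (hux.const_smul c).deriv, hux.deriv]

theorem inner_topDeriv (hn : 1 < n) (y z : sobolevZero n) :
    inner ℂ (topDeriv hn z) (topDeriv hn y) =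
      ∫ x in (0 : ℝ)..1, iteratedDeriv n y.1 x * starRingEnd ℂ (iteratedDeriv n z.1 x) := by
  rw [← unit_integral_eq, L2.inner_def]
  refine integral_congr_ae ?_
  filter_upwards [(memLp_iteratedDeriv hn y.2).coeFn_toLp,
    (memLp_iteratedDeriv hn z.2).coeFn_toLp] with x hy hz
  change inner ℂ ((memLp_iteratedDeriv hn z.2).toLp _ x) ((memLp_iteratedDeriv hn y.2).toLp _ x) = _
  rw [hy, hz]
  rfl

theorem norm_topDeriv (hn : 1 < n) (y : sobolevZero n) :
    ‖topDeriv hn y‖ = (eLpNorm (iteratedDeriv n y.1) 2 unitMeasure).toReal :=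
  Lp.norm_toLp _ (memLp_iteratedDeriv hn y.2)

theorem norm_topDeriv_sq (hn : 1 < n) (y : sobolevZero n) :
    ‖topDeriv hn y‖ ^ 2 = ∫ x in (0 : ℝ)..1, ‖iteratedDeriv n y.1 x‖ ^ 2 := by
  rw [norm_topDeriv, toReal_eLpNorm_sq (memLp_iteratedDeriv hn y.2)]

theorem norm_iteratedDeriv_le_topDeriv (hn : 1 < n) (y : sobolevZero n) {k : ℕ} (hk : k < n)
    {x : ℝ} (hx : x ∈ Icc (0 : ℝ) 1) : ‖iteratedDeriv k y.1 x‖ ≤ ‖topDeriv hn y‖ := by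
  rw [norm_topDeriv]
  exact norm_iteratedDeriv_le (memLp_iteratedDeriv hn y.2)
    (fun k hk x hx => iteratedDeriv_eq_integral hn y.2 hk hx) hk hx

theorem topDeriv_injective (hn : 1 < n) : Function.Injective (topDeriv hn) := by
  rw [← LinearMap.ker_eq_bot, LinearMap.ker_eq_bot']
  intro y hy
  refine Subtype.ext (funext fun x => ?_)
  by_cases hx : x ∈ Icc (0 : ℝ) 1
  · have := norm_iteratedDeriv_le_topDeriv hn y (k := 0) (by omega) hx
    rw [hy, norm_zero, iteratedDeriv_zero] at this
    simpa using this
  · exact y.2.1 x hx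

theorem integrable_sq_iteratedDeriv (hn : 1 < n) (hy : y ∈ sobolevZero n) {s t : ℝ}
    (hs : s ∈ Icc (0 : ℝ) 1) (ht : t ∈ Icc (0 : ℝ) 1) :
    IntervalIntegrable (fun x => ‖iteratedDeriv n y x‖ ^ 2) volume s t := by
  have h : IntegrableOn (fun x => ‖iteratedDeriv n y x‖ ^ 2) (Icc 0 1) volume :=
    (memLp_iteratedDeriv hn hy).integrable_norm_pow (by norm_num)
  rw [intervalIntegrable_iff]
  refine h.mono_set ?_
  rw [uIoc_eq_union]
  rintro x (hx | hx)
  · exact ⟨hs.1.trans hx.1.le, hx.2.trans ht.2⟩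
  · exact ⟨ht.1.trans hx.1.le, hx.2.trans hs.2⟩

/-- The energy of a rescaled piece of a function whose derivatives of order less than `n` vanish
at the left end of the piece controls the piece and its derivatives. -/
theorem norm_iteratedDeriv_comp_affine_le (hn : 1 < n) (y : sobolevZero n) {p h : ℝ}
    (hp : 0 ≤ p) (hh : 0 < h) (hph : p + h ≤ 1) (hzero : ∀ k < n, iteratedDeriv k y.1 p = 0)
    {k : ℕ} (hk : k < n) {x : ℝ} (hx : x ∈ Icc (0 : ℝ) 1) :
    ‖iteratedDeriv k (fun x => y.1 (p + h * x)) x‖ ≤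
      Real.sqrt (h ^ (2 * n - 1)) * ‖topDeriv hn y‖ := by
  have hmem : ∀ x ∈ Icc (0 : ℝ) 1, p + h * x ∈ Icc (0 : ℝ) 1 := by
    intro x hx
    constructor
    · have := mul_nonneg hh.le hx.1; linarith
    · have := mul_le_mul_of_nonneg_left hx.2 hh.le; linarith
  have hp1 : p ∈ Icc (0 : ℝ) 1 := by simpa using hmem 0 (by simp)
  -- `w` need not vanish at 1, so it may lie outside the Sobolev space; `norm_iteratedDeriv_le` asks
  -- only for primitives starting at 0.
  set w : ℝ → ℂ := fun x => y.1 (p + h * x) with hw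
  -- The chain rule gives h^(2n) and the change of variables takes back one factor h. This is the
  -- origin of the exponent 2n - 1.
  have hscale : ∫ x in (0 : ℝ)..1, ‖iteratedDeriv n w x‖ ^ 2 =
      h ^ (2 * n - 1) * ∫ x in p..(p + h), ‖iteratedDeriv n y.1 x‖ ^ 2 := by
    simp_rw [hw, norm_iteratedDeriv_comp_affine_sq]
    rw [intervalIntegral.integral_const_mul,
      intervalIntegral.integral_comp_add_mul (fun t => ‖iteratedDeriv n y.1 t‖ ^ 2) hh.ne' p,
      mul_zero, mul_one, add_zero, smul_eq_mul, ← mul_assoc]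
    congr 1
    have : 2 * n = (2 * n - 1) + 1 := by omega
    rw [this, pow_succ]
    field_simp
    congr 1
  have hmeas : MemLp (iteratedDeriv n w) 2 unitMeasure := by
    have hae : AEStronglyMeasurable (iteratedDeriv n w) unitMeasure := by
      have : iteratedDeriv n w = deriv (iteratedDeriv (n - 1) w) := iteratedDeriv_eq_deriv hn
      rw [this]
      exact (stronglyMeasurable_deriv _).aestronglyMeasurable
    rw [memLp_two_iff_integrable_sq_norm hae]
    change IntegrableOn _ _ _
    rw [← intervalIntegrable_iff_integrableOn_Icc_of_le zero_le_one]
    simp_rw [hw, norm_iteratedDeriv_comp_affine_sq]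
    refine IntervalIntegrable.const_mul ?_ _
    have h1 := (integrable_sq_iteratedDeriv hn y.2 hp1 (by simpa using hmem 1 (by simp) :
      p + h ∈ Icc (0 : ℝ) 1))
    have h2 := (h1.comp_add_left p).comp_mul_left (c := h)
    simpa [hh.ne'] using h2
  have hint : ∀ k < n, ∀ x ∈ Icc (0 : ℝ) 1, iteratedDeriv k w x =
      ∫ t in (0 : ℝ)..x, iteratedDeriv (k + 1) w t := by
    intro k hk x hx
    rw [hw, iteratedDeriv_comp_affine, iteratedDeriv_comp_affine]
    have h1 := iteratedDeriv_sub_eq_integral hn y.2 hk hp1 (hmem x hx)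
    rw [hzero k hk, sub_zero] at h1
    rw [intervalIntegral.integral_const_mul,
      intervalIntegral.integral_comp_add_mul (fun t => iteratedDeriv (k + 1) y.1 t) hh.ne' p,
      mul_zero, add_zero, ← h1, Complex.real_smul]
    have : (h : ℂ) ≠ 0 := by exact_mod_cast hh.ne'
    push_cast
    field_simp
    ring
  refine (norm_iteratedDeriv_le hmeas hint hk hx).trans ?_
  refine abs_le_of_sq_le_sq' ?_ (by positivity) |>.2
  rw [toReal_eLpNorm_sq hmeas, hscale, mul_pow, Real.sq_sqrt (by positivity), norm_topDeriv_sq]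
  refine mul_le_mul_of_nonneg_left ?_ (by positivity)
  exact intervalIntegral.integral_mono_interval hp (by linarith) hph
    (Eventually.of_forall fun t => by positivity)
    (integrable_sq_iteratedDeriv hn y.2 (by simp) (by simp))

end Sobolev

/-! ### The partition of the unit interval -/

section Nodes

variable {N : ℕ} {a β d : ℕ → ℝ} {P : L2}

theorem node_zero (a : ℕ → ℝ) : node a 0 = 0 := by simp [node]

theorem node_succ (a : ℕ → ℝ) (k : ℕ) : node a (k + 1) = node a k + a (k + 1) := by
  unfold node; rw [Finset.sum_Icc_succ_top (by omega)]

theorem node_sub_one_add (a : ℕ → ℝ) {k : ℕ} (hk : 1 ≤ k) : node a (k - 1) + a k = node a k := by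
  obtain ⟨j, rfl⟩ : ∃ j, k = j + 1 := ⟨k - 1, by omega⟩
  rw [node_succ]; rfl

theorem IsSelfSimilar.node_last (hP : IsSelfSimilar N a β d P) : node a N = 1 := hP.sum_a

theorem IsSelfSimilar.node_lt (hP : IsSelfSimilar N a β d P) {j k : ℕ} (hjk : j < k)
    (hk : k ≤ N) : node a j < node a k := by
  induction k with
  | zero => omega
  | succ k ih =>
    have h1 : 0 < a (k + 1) := hP.a_pos _ (Finset.mem_Icc.2 ⟨by omega, hk⟩)
    rw [node_succ]
    rcases Nat.lt_succ_iff_lt_or_eq.1 hjk with h | h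
    · linarith [ih h (by omega)]
    · rw [h]; linarith

theorem IsSelfSimilar.node_le (hP : IsSelfSimilar N a β d P) {j k : ℕ} (hjk : j ≤ k)
    (hk : k ≤ N) : node a j ≤ node a k := by
  rcases hjk.eq_or_lt with rfl | h
  · exact le_rfl
  · exact (hP.node_lt h hk).le

theorem IsSelfSimilar.node_mem (hP : IsSelfSimilar N a β d P) {k : ℕ} (hk : k ≤ N) :
    node a k ∈ Icc (0 : ℝ) 1 :=
  ⟨node_zero a ▸ hP.node_le (Nat.zero_le k) hk, hP.node_last ▸ hP.node_le hk le_rfl⟩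

theorem IsSelfSimilar.similarityOp_eq (hP : IsSelfSimilar N a β d P) (f : ℝ → ℝ) {k : ℕ}
    (hk : k ∈ Finset.Icc 1 N) {x : ℝ} (hx : x ∈ Ioo (node a (k - 1)) (node a k)) :
    similarityOp N a β d f x = β k + d k * f ((x - node a (k - 1)) / a k) := by
  unfold similarityOp
  rw [Finset.mem_Icc] at hk
  rw [Finset.sum_eq_single k, indicator_of_mem hx]
  · intro j hj hjk
    rw [Finset.mem_Icc] at hj
    refine indicator_of_notMem (fun hxj => ?_) _
    rcases lt_or_gt_of_ne hjk with h | h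
    · have := hP.node_le (j := j) (k := k - 1) (by omega) (by omega)
      exact absurd (hxj.2.trans_le this) (not_lt.2 hx.1.le)
    · have := hP.node_le (j := k) (k := j - 1) (by omega) (by omega)
      exact absurd (hx.2.trans_le this) (not_lt.2 hxj.1.le)
  · intro h; exact absurd (Finset.mem_Icc.2 hk) h

end Nodes

/-! ### The self-similarity identity for ρ = P' -/

section MassForm

/-- The pairing of the generalized derivative of `P` with a smooth function `f`; the boundary terms
are those of a function `P` equal to `β 1` near `0` and to `β N` near `1`. -/
noncomputable def massForm (N : ℕ) (β : ℕ → ℝ) (P : L2) (f : ℝ → ℂ) : ℂ :=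
  -(∫ x in (0 : ℝ)..1, (((P : ℝ → ℝ) x : ℝ) : ℂ) * deriv f x) + β N * f 1 - β 1 * f 0

variable {N : ℕ} {a β d : ℕ → ℝ} {P : L2} {m : ℕ} {f g : ℝ → ℂ}

theorem intervalIntegrable_P (P : L2) {s t : ℝ} (hs : s ∈ Icc (0 : ℝ) 1)
    (ht : t ∈ Icc (0 : ℝ) 1) :
    IntervalIntegrable (fun x => (((P : ℝ → ℝ) x : ℝ) : ℂ)) volume s t :=
  intervalIntegrable_of_memLp (Lp.memLp P).ofReal hs ht

theorem intervalIntegrable_P_mul (P : L2) (hf : ContDiff ℝ 1 f) {s t : ℝ}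
    (hs : s ∈ Icc (0 : ℝ) 1) (ht : t ∈ Icc (0 : ℝ) 1) :
    IntervalIntegrable (fun x => (((P : ℝ → ℝ) x : ℝ) : ℂ) * deriv f x) volume s t :=
  (intervalIntegrable_P P hs ht).mul_continuousOn (hf.continuous_deriv le_rfl).continuousOn

theorem massForm_add (hf : ContDiff ℝ 1 f) (hg : ContDiff ℝ 1 g) :
    massForm N β P (f + g) = massForm N β P f + massForm N β P g := by
  have h : ∀ x, deriv (f + g) x = deriv f x + deriv g x := fun x =>
    deriv_add (hf.differentiable (by norm_num) x) (hg.differentiable (by norm_num) x)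
  unfold massForm
  simp_rw [h, mul_add]
  rw [intervalIntegral.integral_add (intervalIntegrable_P_mul P hf (by simp) (by simp))
    (intervalIntegrable_P_mul P hg (by simp) (by simp))]
  simp only [Pi.add_apply]
  ring

theorem massForm_smul (c : ℂ) (f : ℝ → ℂ) :
    massForm N β P (c • f) = c * massForm N β P f := by
  have h : ∀ x, deriv (c • f) x = c * deriv f x := fun x => by
    rw [deriv_const_smul_field, smul_eq_mul]
  unfold massForm
  simp_rw [h, mul_left_comm _ c]
  rw [intervalIntegral.integral_const_mul]
  simp only [Pi.smul_apply, smul_eq_mul]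
  ring

theorem massForm_conj (f : ℝ → ℂ) :
    massForm N β P (fun x => starRingEnd ℂ (f x)) = starRingEnd ℂ (massForm N β P f) := by
  have h : ∀ x, deriv (fun x => starRingEnd ℂ (f x)) x = starRingEnd ℂ (deriv f x) := fun x =>
    deriv.star (f := f) (x := x)
  unfold massForm
  simp_rw [h]
  simp only [map_sub, map_add, map_neg, map_mul, Complex.conj_ofReal]
  congr 3
  rw [intervalIntegral.integral_of_le zero_le_one, intervalIntegral.integral_of_le zero_le_one,
    ← integral_conj]
  simp

theorem massForm_eq_zero (hf : ∀ x ∈ Icc (0 : ℝ) 1, f x = 0) : massForm N β P f = 0 := by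
  unfold massForm
  rw [hf 0 (by simp), hf 1 (by simp)]
  have : ∫ x in (0 : ℝ)..1, (((P : ℝ → ℝ) x : ℝ) : ℂ) * deriv f x = 0 := by
    rw [← unit_integral_eq]
    refine integral_eq_zero_of_ae ?_
    filter_upwards [ae_mem_Ioo_unit] with x hx
    have : f =ᶠ[𝓝 x] fun _ => 0 := by
      filter_upwards [Ioo_mem_nhds hx.1 hx.2] with t ht
      exact hf t (Ioo_subset_Icc_self ht)
    rw [this.deriv_eq]
    simp
  rw [this]; simp

theorem contDiff_comp_affine {k : WithTop ℕ∞} (hf : ContDiff ℝ k f) (p h : ℝ) :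
    ContDiff ℝ k (fun x => f (p + h * x)) :=
  hf.comp (contDiff_const.add (contDiff_const.mul contDiff_id))

/-- After substitution the Jacobian `a k` cancels the chain-rule factor, so the copy of ρ in the
`k`-th piece is weighted by `d k` alone. -/
theorem IsSelfSimilar.integral_piece (hP : IsSelfSimilar N a β d P) (hf : ContDiff ℝ 1 f)
    {k : ℕ} (hk : k ∈ Finset.Icc 1 N) :
    ∫ x in node a (k - 1)..node a k, (((P : ℝ → ℝ) x : ℝ) : ℂ) * deriv f x =
      β k * (f (node a k) - f (node a (k - 1))) +
        d k * ∫ x in (0 : ℝ)..1, (((P : ℝ → ℝ) x : ℝ) : ℂ) *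
          deriv (fun t => f (node a (k - 1) + a k * t)) x := by
  have hk' := Finset.mem_Icc.1 hk
  have ha : 0 < a k := hP.a_pos k hk
  have hadd := node_sub_one_add a hk'.1
  set p := node a (k - 1) with hp
  have hp01 : p ∈ Icc (0 : ℝ) 1 := hP.node_mem (by omega)
  have hq01 : node a k ∈ Icc (0 : ℝ) 1 := hP.node_mem hk'.2
  have hle : p ≤ node a k := by linarith
  have hfd : Differentiable ℝ f := hf.differentiable (by norm_num)
  have hfc : Continuous (deriv f) := hf.continuous_deriv le_rfl
  have h1 : ∫ x in p..node a k, (((P : ℝ → ℝ) x : ℝ) : ℂ) * deriv f x =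
      ∫ x in p..node a k, ((β k : ℂ) * deriv f x +
        d k * ((((P : ℝ → ℝ) ((x - p) / a k) : ℝ) : ℂ) * deriv f x)) := by
    rw [intervalIntegral.integral_of_le hle, intervalIntegral.integral_of_le hle,
      integral_Ioc_eq_integral_Ioo, integral_Ioc_eq_integral_Ioo]
    refine integral_congr_ae ?_
    have h2 : ∀ᵐ x ∂(volume.restrict (Ioo p (node a k))),
        (P : ℝ → ℝ) x = similarityOp N a β d P x :=
      ae_restrict_of_ae_restrict_of_subset
        ((Ioo_subset_Icc_self).trans (Icc_subset_Icc hp01.1 hq01.2)) hP.fixed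
    filter_upwards [h2, ae_restrict_mem measurableSet_Ioo] with x hx hxm
    rw [hx, hP.similarityOp_eq _ hk hxm]
    push_cast
    ring
  have hcomp : IntervalIntegrable (fun x => (((P : ℝ → ℝ) ((x - p) / a k) : ℝ) : ℂ)) volume
      p (node a k) := by
    have h0 := intervalIntegrable_P P (s := 0) (t := 1) (by simp) (by simp)
    have h2 := (h0.comp_mul_left (c := (a k)⁻¹)).comp_sub_right p
    have e1 : (0 : ℝ) / (a k)⁻¹ + p = p := by simp
    have e2 : (1 : ℝ) / (a k)⁻¹ + p = node a k := by
      rw [one_div, inv_inv, add_comm]; exact hadd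
    rw [e1, e2] at h2
    refine h2.congr ?_
    intro x _
    simp only [div_eq_inv_mul]
  rw [h1, intervalIntegral.integral_add ((hfc.intervalIntegrable _ _).const_mul _)
    ((hcomp.mul_continuousOn hfc.continuousOn).const_mul _), intervalIntegral.integral_const_mul,
    intervalIntegral.integral_const_mul,
    intervalIntegral.integral_deriv_eq_sub (fun x _ => hfd x) (hfc.intervalIntegrable _ _)]
  congr 2
  have h3 := intervalIntegral.integral_comp_add_mul (a := 0) (b := 1)
    (fun x => (((P : ℝ → ℝ) ((x - p) / a k) : ℝ) : ℂ) * deriv f x) ha.ne' p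
  rw [mul_zero, add_zero, mul_one, hadd] at h3
  have h4 : ∀ x, deriv (fun t => f (p + a k * t)) x = (a k : ℂ) * deriv f (p + a k * x) := by
    intro x
    have := congrFun (iteratedDeriv_comp_affine f p (a k) 1) x
    rw [iteratedDeriv_one, iteratedDeriv_one, pow_one] at this
    exact this
  have h5 : ∀ x, (p + a k * x - p) / a k = x := fun x => by field_simp; ring
  simp_rw [h5] at h3
  have ha' : (a k : ℂ) ≠ 0 := by exact_mod_cast ha.ne'
  have h6 : ∫ x in (0 : ℝ)..1, (((P : ℝ → ℝ) x : ℝ) : ℂ) *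
          deriv (fun t => f (p + a k * t)) x =
      (a k : ℂ) * ∫ x in (0 : ℝ)..1, (((P : ℝ → ℝ) x : ℝ) : ℂ) * deriv f (p + a k * x) := by
    rw [← intervalIntegral.integral_const_mul]
    refine intervalIntegral.integral_congr fun x _ => ?_
    simp only [h4]; ring
  rw [h6, h3, Complex.real_smul]
  push_cast
  rw [← mul_assoc, mul_inv_cancel₀ ha', one_mul]

theorem sum_Icc_abel (β' F : ℕ → ℂ) {N : ℕ} (hN : 1 ≤ N) :
    -(∑ k ∈ Finset.Icc 1 N, β' k * (F k - F (k - 1))) + β' N * F N - β' 1 * F 0 =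
      ∑ k ∈ Finset.Icc 1 (N - 1), (β' (k + 1) - β' k) * F k := by
  induction N, hN using Nat.le_induction with
  | base => simp; ring
  | succ N hN ih =>
    obtain ⟨M, rfl⟩ : ∃ M, N = M + 1 := ⟨N - 1, by omega⟩
    simp only [Nat.add_sub_cancel] at ih ⊢
    rw [Finset.sum_Icc_succ_top (by omega) (fun k => (β' (k + 1) - β' k) * F k), ← ih,
      Finset.sum_Icc_succ_top (by omega : 1 ≤ M + 1 + 1)]
    simp only [Nat.add_sub_cancel]
    ring

/-- The position of the `m`-th piece of the self-similar partition. -/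
noncomputable def shrink (a : ℕ → ℝ) (m : ℕ) (x : ℝ) : ℝ := node a (m - 1) + a m * x

/-- Abel summation over the pieces turns the jumps of β into atoms at the nodes, and the `m`-th
piece adds d_m times the integral for f ∘ S. The composite f ∘ S no longer vanishes at 0 and 1, so
the boundary terms in `massForm` are needed to close the recursion; compensating for them puts d_m
β_1 into ζ_(m-1) and -d_m β_N into ζ_m. The conditions on `f` cover the cases where one of these
corrections sits at an end of [0, 1] instead of an inner node. -/
theorem IsZeroSpectralOrder.massForm_eq (hP : IsZeroSpectralOrder N a β d m P)
    (hf : ContDiff ℝ 1 f) (h0 : m = 1 → f 0 = 0) (h1 : m = N → f 1 = 0) :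
    massForm N β P f = ∑ k ∈ Finset.Icc 1 (N - 1), (zeta N β d m k : ℂ) * f (node a k) +
      d m * massForm N β P (fun x => f (shrink a m x)) := by
  have hS := hP.toIsSelfSimilar
  have hm := Finset.mem_Icc.1 hP.m_mem
  have hN := hS.one_lt
  have hint : ∫ x in (0 : ℝ)..1, (((P : ℝ → ℝ) x : ℝ) : ℂ) * deriv f x =
      ∑ k ∈ Finset.Icc 1 N, ∫ x in node a (k - 1)..node a k,
        (((P : ℝ → ℝ) x : ℝ) : ℂ) * deriv f x := by
    have h := intervalIntegral.sum_integral_adjacent_intervals (μ := volume) (a := node a) (n := N)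
      (f := fun x => (((P : ℝ → ℝ) x : ℝ) : ℂ) * deriv f x)
      (fun k hk => intervalIntegrable_P_mul P hf (hS.node_mem (by omega)) (hS.node_mem (by omega)))
    rw [node_zero, hS.node_last] at h
    rw [← h, ← Finset.Ico_add_one_right_eq_Icc, Finset.sum_Ico_eq_sum_range]
    refine Finset.sum_congr (by simp) fun k _ => ?_
    rw [Nat.add_comm 1 k, Nat.add_sub_cancel]
  have hsum : ∑ k ∈ Finset.Icc 1 N, ∫ x in node a (k - 1)..node a k,
        (((P : ℝ → ℝ) x : ℝ) : ℂ) * deriv f x =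
      ∑ k ∈ Finset.Icc 1 N, (β k : ℂ) * (f (node a k) - f (node a (k - 1))) +
        d m * ∫ x in (0 : ℝ)..1, (((P : ℝ → ℝ) x : ℝ) : ℂ) *
          deriv (fun t => f (node a (m - 1) + a m * t)) x := by
    rw [Finset.sum_congr rfl fun k hk => hS.integral_piece hf hk, Finset.sum_add_distrib]
    congr 1
    refine Finset.sum_eq_single m (fun k hk hkm => ?_) fun h => absurd hP.m_mem h
    rw [hP.d_eq_zero k hk hkm]; simp
  have hzeta : ∑ k ∈ Finset.Icc 1 (N - 1), (zeta N β d m k : ℂ) * f (node a k) =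
      ∑ k ∈ Finset.Icc 1 (N - 1), ((β (k + 1) : ℂ) - β k) * f (node a k) +
        d m * β 1 * f (node a (m - 1)) - d m * β N * f (node a m) := by
    have hz : ∀ k ∈ Finset.Icc 1 (N - 1), (zeta N β d m k : ℂ) * f (node a k) =
        ((β (k + 1) : ℂ) - β k) * f (node a k) +
          (if k = m - 1 then (d m * β 1 : ℂ) * f (node a k) else 0) -
          (if k = m then (d m * β N : ℂ) * f (node a k) else 0) := by
      intro k hk
      unfold zeta
      by_cases hk1 : k + 1 = m
      · have e1 : k = m - 1 := by omega
        have e2 : k ≠ m := by omega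
        rw [if_pos hk1, if_pos e1, if_neg e2, ← hk1, Nat.add_sub_cancel]
        push_cast; ring
      · have e1 : k ≠ m - 1 := by omega
        rw [if_neg hk1, if_neg e1]
        by_cases hk2 : k = m
        · rw [if_pos hk2, if_pos hk2, hk2]; push_cast; ring
        · rw [if_neg hk2, if_neg hk2]; push_cast; ring
    rw [Finset.sum_congr rfl hz, Finset.sum_sub_distrib, Finset.sum_add_distrib,
      Finset.sum_ite_eq', Finset.sum_ite_eq']
    congr 1
    · congr 1
      -- For m = 1 the index m - 1 = 0 is missing from the sum, and the term it would carry vanishes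
      -- with f 0; m = N is symmetric.
      by_cases h : m = 1
      · rw [if_neg (by simp [h]), h, Nat.sub_self, node_zero, h0 h, mul_zero]
      · rw [if_pos (Finset.mem_Icc.2 ⟨by omega, by omega⟩)]
    · by_cases h : m = N
      · rw [if_neg (by rw [Finset.mem_Icc]; omega), h, hS.node_last, h1 h, mul_zero]
      · rw [if_pos (Finset.mem_Icc.2 ⟨by omega, by omega⟩)]
  have habel := sum_Icc_abel (fun k => (β k : ℂ)) (fun k => f (node a k)) hN.le
  simp only [node_zero, hS.node_last] at habel
  rw [hzeta, ← habel]
  unfold massForm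
  rw [hint, hsum]
  have e1 : shrink a m 1 = node a m := by
    unfold shrink; rw [mul_one, node_sub_one_add a hm.1]
  have e0 : shrink a m 0 = node a (m - 1) := by
    unfold shrink; rw [mul_zero, add_zero]
  simp only [e1, e0]
  simp only [shrink]
  ring

theorem shrink_iterate (a : ℕ → ℝ) (m k : ℕ) (x : ℝ) :
    (shrink a m)^[k] x = (shrink a m)^[k] 0 + a m ^ k * x := by
  induction k generalizing x with
  | zero => simp
  | succ k ih =>
    rw [Function.iterate_succ_apply', Function.iterate_succ_apply', ih]
    unfold shrink
    ring

theorem IsZeroSpectralOrder.shrink_mem (hP : IsZeroSpectralOrder N a β d m P) {x : ℝ}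
    (hx : x ∈ Icc (0 : ℝ) 1) : shrink a m x ∈ Icc (node a (m - 1)) (node a m) := by
  have hm := Finset.mem_Icc.1 hP.m_mem
  have ha := hP.a_pos m hP.m_mem
  rw [← node_sub_one_add a hm.1]
  unfold shrink
  constructor
  · have := mul_nonneg ha.le hx.1; linarith
  · have := mul_le_mul_of_nonneg_left hx.2 ha.le; linarith

theorem IsZeroSpectralOrder.shrink_mem_unit (hP : IsZeroSpectralOrder N a β d m P) {x : ℝ}
    (hx : x ∈ Icc (0 : ℝ) 1) : shrink a m x ∈ Icc (0 : ℝ) 1 := by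
  have hm := Finset.mem_Icc.1 hP.m_mem
  have h := hP.shrink_mem hx
  exact ⟨(hP.node_mem (by omega : m - 1 ≤ N)).1.trans h.1, h.2.trans (hP.node_mem hm.2).2⟩

theorem IsZeroSpectralOrder.shrink_iterate_mem (hP : IsZeroSpectralOrder N a β d m P) (k : ℕ)
    {x : ℝ} (hx : x ∈ Icc (0 : ℝ) 1) : (shrink a m)^[k] x ∈ Icc (0 : ℝ) 1 := by
  induction k with
  | zero => exact hx
  | succ k ih => rw [Function.iterate_succ_apply']; exact hP.shrink_mem_unit ih

/-- Lists the atoms of the first `k` generations, leaving a remainder on the nested piece S^k[0, 1].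
The boundary conditions survive the iteration because S fixes 0 when m = 1 and fixes 1 when m = N.
-/
theorem IsZeroSpectralOrder.massForm_eq_iterate (hP : IsZeroSpectralOrder N a β d m P)
    (hf : ContDiff ℝ 1 f) (h0 : m = 1 → f 0 = 0) (h1 : m = N → f 1 = 0) (k : ℕ) :
    massForm N β P f = ∑ j ∈ Finset.range k, (d m : ℂ) ^ j *
        ∑ i ∈ Finset.Icc 1 (N - 1), (zeta N β d m i : ℂ) * f ((shrink a m)^[j] (node a i)) +
      (d m : ℂ) ^ k * massForm N β P (fun x => f ((shrink a m)^[k] x)) := by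
  have hm := Finset.mem_Icc.1 hP.m_mem
  have fix0 : m = 1 → ∀ k, (shrink a m)^[k] 0 = 0 := fun h k =>
    Function.iterate_fixed (by subst h; unfold shrink; simp [node_zero]) k
  have fix1 : m = N → ∀ k, (shrink a m)^[k] 1 = 1 := fun h k =>
    Function.iterate_fixed (by
      unfold shrink; rw [mul_one, node_sub_one_add a hm.1, h, hP.node_last]) k
  induction k with
  | zero => simp
  | succ k ih =>
    have hc : ContDiff ℝ 1 (fun x => f ((shrink a m)^[k] x)) := by
      have h : (fun x => f ((shrink a m)^[k] x)) =
          fun x => f ((shrink a m)^[k] 0 + a m ^ k * x) :=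
        funext fun x => congrArg f (shrink_iterate a m k x)
      rw [h]
      exact contDiff_comp_affine hf _ _
    rw [ih, Finset.sum_range_succ, hP.massForm_eq hc (fun h => by rw [fix0 h, h0 h])
      (fun h => by rw [fix1 h, h1 h])]
    simp only [Function.iterate_succ_apply]
    ring

end MassForm

/-! ### Completeness: characterizing n-th derivatives by iterated primitives -/

section IteratedPrimitive

/-- The `i`-fold primitive from `0` of the extension by zero of a function on `[0, 1]`. -/
noncomputable def iterPrim (u : ℝ → ℂ) : ℕ → ℝ → ℂ
  | 0 => indicator (Icc 0 1) u
  | i + 1 => fun x => ∫ t in (0 : ℝ)..x, iterPrim u i t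

variable {u v : ℝ → ℂ}

theorem iterPrim_succ (u : ℝ → ℂ) (i : ℕ) (x : ℝ) :
    iterPrim u (i + 1) x = ∫ t in (0 : ℝ)..x, iterPrim u i t := rfl

theorem intervalIntegrable_iterPrim (hu : MemLp u 2 unitMeasure) (i : ℕ) (s t : ℝ) :
    IntervalIntegrable (iterPrim u i) volume s t := by
  induction i generalizing s t with
  | zero =>
    have h : IntegrableOn u (Icc 0 1) volume := hu.integrable (by norm_num)
    exact ((integrable_indicator_iff measurableSet_Icc).2 h).intervalIntegrable
  | succ i ih => exact (intervalIntegral.continuous_primitive ih 0).intervalIntegrable s t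

theorem continuous_iterPrim (hu : MemLp u 2 unitMeasure) (i : ℕ) :
    Continuous (iterPrim u (i + 1)) :=
  intervalIntegral.continuous_primitive (intervalIntegrable_iterPrim hu i) 0

theorem hasDerivAt_iterPrim (hu : MemLp u 2 unitMeasure) (i : ℕ) (x : ℝ) :
    HasDerivAt (iterPrim u (i + 2)) (iterPrim u (i + 1) x) x :=
  intervalIntegral.integral_hasDerivAt_right (intervalIntegrable_iterPrim hu _ _ _)
    (continuous_iterPrim hu i).stronglyMeasurable.stronglyMeasurableAtFilter
    (continuous_iterPrim hu i).continuousAt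

theorem deriv_iterPrim (hu : MemLp u 2 unitMeasure) (i : ℕ) :
    deriv (iterPrim u (i + 2)) = iterPrim u (i + 1) :=
  funext fun x => (hasDerivAt_iterPrim hu i x).deriv

theorem contDiff_iterPrim (hu : MemLp u 2 unitMeasure) (i : ℕ) :
    ContDiff ℝ i (iterPrim u (i + 1)) := by
  induction i with
  | zero => exact contDiff_zero.2 (continuous_iterPrim hu 0)
  | succ i ih =>
    rw [Nat.cast_succ, contDiff_succ_iff_deriv]
    refine ⟨fun x => (hasDerivAt_iterPrim hu i x).differentiableAt, by simp, ?_⟩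
    rw [deriv_iterPrim hu]
    exact ih

theorem iteratedDeriv_iterPrim (hu : MemLp u 2 unitMeasure) (i k : ℕ) :
    iteratedDeriv k (iterPrim u (i + 1 + k)) = iterPrim u (i + 1) := by
  induction k with
  | zero => simp
  | succ k ih =>
    rw [iteratedDeriv_succ']
    have : i + 1 + (k + 1) = (i + k) + 2 := by ring
    rw [this, deriv_iterPrim hu]
    have : i + k + 1 = i + 1 + k := by ring
    rw [this, ih]

/-- A primitive of a function supported in [0, 1] is constant beyond 1, and that constant is its
value at 1. This supplies the normalization outside [0, 1] required by `sobolevZero`. -/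
theorem iterPrim_eq_zero (hu : MemLp u 2 unitMeasure) {n : ℕ}
    (h : ∀ i < n, iterPrim u (i + 1) 1 = 0) (i : ℕ) (hi : i ≤ n) :
    ∀ x, x ∉ Icc (0 : ℝ) 1 → iterPrim u i x = 0 := by
  induction i with
  | zero => intro x hx; exact indicator_of_notMem hx u
  | succ i ih =>
    have ih := ih (by omega)
    intro x hx
    rw [iterPrim_succ]
    rcases lt_or_ge x 0 with h0 | h0
    · refine intervalIntegral.integral_zero_ae ?_
      have hne : ∀ᵐ t : ℝ, t ≠ 0 := by simp [ae_iff]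
      filter_upwards [hne] with t ht htm
      rw [uIoc_of_ge h0.le] at htm
      refine ih t fun h' => ?_
      exact ht (le_antisymm htm.2 h'.1)
    · have h1 : 1 < x := by
        by_contra h1
        exact hx ⟨h0, not_lt.1 h1⟩
      rw [← intervalIntegral.integral_add_adjacent_intervals
        (intervalIntegrable_iterPrim hu i 0 1) (intervalIntegrable_iterPrim hu i 1 x),
        ← iterPrim_succ, h i (by omega), zero_add]
      refine intervalIntegral.integral_zero_ae (Eventually.of_forall fun t htm => ?_)
      rw [uIoc_of_le h1.le] at htm
      exact ih t fun h' => not_lt.2 h'.2 htm.1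

theorem norm_iterPrim_sub_le (u v : Lp ℂ 2 unitMeasure) (i : ℕ) {x : ℝ}
    (hx : x ∈ Icc (0 : ℝ) 1) :
    ‖iterPrim u (i + 1) x - iterPrim v (i + 1) x‖ ≤ ‖u - v‖ := by
  induction i generalizing x with
  | zero =>
    have h1 : ∀ w : Lp ℂ 2 unitMeasure, iterPrim w (0 + 1) x = ∫ t in (0 : ℝ)..x, w t := by
      intro w
      rw [iterPrim_succ]
      refine intervalIntegral.integral_congr fun t ht => ?_
      rw [uIcc_of_le hx.1] at ht
      have htm : t ∈ Icc (0 : ℝ) 1 := ⟨ht.1, ht.2.trans hx.2⟩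
      exact indicator_of_mem htm _
    rw [h1, h1, ← intervalIntegral.integral_sub
      (intervalIntegrable_of_memLp (Lp.memLp u) (by simp) hx)
      (intervalIntegrable_of_memLp (Lp.memLp v) (by simp) hx)]
    refine (norm_intervalIntegral_le ((Lp.memLp u).sub (Lp.memLp v)) hx).trans_eq ?_
    rw [Lp.norm_def, eLpNorm_congr_ae (Lp.coeFn_sub u v)]
  | succ i ih =>
    rw [iterPrim_succ, iterPrim_succ, ← intervalIntegral.integral_sub
      (intervalIntegrable_iterPrim (Lp.memLp u) _ _ _)
      (intervalIntegrable_iterPrim (Lp.memLp v) _ _ _)]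
    have h1 : ∀ t ∈ uIoc 0 x, ‖iterPrim u (i + 1) t - iterPrim v (i + 1) t‖ ≤ ‖u - v‖ := by
      intro t ht
      rw [uIoc_of_le hx.1] at ht
      exact ih ⟨ht.1.le, ht.2.trans hx.2⟩
    refine (intervalIntegral.norm_integral_le_of_norm_le_const h1).trans ?_
    rw [sub_zero, abs_of_nonneg hx.1]
    exact mul_le_of_le_one_right (norm_nonneg _) hx.2

theorem continuous_iterPrim_eval (i : ℕ) :
    Continuous fun u : Lp ℂ 2 unitMeasure => iterPrim u (i + 1) 1 := by
  refine LipschitzWith.continuous (K := 1) (LipschitzWith.of_dist_le_mul fun u v => ?_)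
  rw [dist_eq_norm, dist_eq_norm, NNReal.coe_one, one_mul]
  exact norm_iterPrim_sub_le u v i (by simp)

theorem iterPrim_topDeriv {n : ℕ} (hn : 1 < n) (y : sobolevZero n) {i : ℕ} (hi : i < n) {x : ℝ}
    (hx : x ∈ Icc (0 : ℝ) 1) :
    iterPrim (topDeriv hn y) (i + 1) x = iteratedDeriv (n - (i + 1)) y.1 x := by
  induction i generalizing x with
  | zero =>
    rw [iterPrim_succ, iteratedDeriv_eq_integral hn y.2 (by omega) hx]
    have : n - (0 + 1) + 1 = n := by omega
    rw [this, intervalIntegral.integral_of_le hx.1, intervalIntegral.integral_of_le hx.1]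
    refine integral_congr_ae ?_
    have h1 := (memLp_iteratedDeriv hn y.2).coeFn_toLp
    have hsub : Ioc 0 x ⊆ Icc (0 : ℝ) 1 := fun t ht => ⟨ht.1.le, ht.2.trans hx.2⟩
    filter_upwards [ae_restrict_of_ae_restrict_of_subset hsub h1,
      ae_restrict_mem measurableSet_Ioc] with t ht htm
    exact (indicator_of_mem (hsub htm) _).trans ht
  | succ i ih =>
    rw [iterPrim_succ, iteratedDeriv_eq_integral hn y.2 (by omega) hx]
    have : n - (i + 1 + 1) + 1 = n - (i + 1) := by omega
    rw [this]
    refine intervalIntegral.integral_congr fun t ht => ?_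
    rw [uIcc_of_le hx.1] at ht
    exact ih (by omega) ⟨ht.1, ht.2.trans hx.2⟩

/-- Primitives from 0 satisfy the conditions at 0 automatically, so only the n conditions at 1
restrict `u`. -/
theorem mem_range_topDeriv_iff {n : ℕ} (hn : 1 < n) (u : Lp ℂ 2 unitMeasure) :
    u ∈ LinearMap.range (topDeriv hn) ↔ ∀ i < n, iterPrim u (i + 1) 1 = 0 := by
  constructor
  · rintro ⟨y, rfl⟩ i hi
    rw [iterPrim_topDeriv hn y hi (by simp)]
    exact (y.2.2.2.2 _ (by omega)).2
  · intro h
    have hu := Lp.memLp u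
    obtain ⟨j, rfl⟩ : ∃ j, n = j + 1 := ⟨n - 1, by omega⟩
    have hder : ∀ k ≤ j, iteratedDeriv k (iterPrim u (j + 1)) = iterPrim u (j - k + 1) := by
      intro k hk
      have := iteratedDeriv_iterPrim hu (j - k) k
      rwa [show j - k + 1 + k = j + 1 by omega] at this
    have hmem : iterPrim u (j + 1) ∈ sobolevZero (j + 1) := by
      refine ⟨iterPrim_eq_zero hu h _ le_rfl, ?_, ⟨u, hu, ?_⟩, ?_⟩
      · exact contDiff_iterPrim hu j
      · intro x hx
        rw [Nat.add_sub_cancel, hder j le_rfl, Nat.sub_self, iterPrim_succ]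
        refine intervalIntegral.integral_congr fun t ht => ?_
        rw [uIcc_of_le hx.1] at ht
        have htm : t ∈ Icc (0 : ℝ) 1 := ⟨ht.1, ht.2.trans hx.2⟩
        exact indicator_of_mem htm _
      · intro k hk
        rw [hder k (by omega)]
        exact ⟨by rw [iterPrim_succ, intervalIntegral.integral_same], h _ (by omega)⟩
    refine ⟨⟨_, hmem⟩, ?_⟩
    refine Lp.ext ?_
    refine (memLp_iteratedDeriv hn hmem).coeFn_toLp.trans ?_
    have h1 := (intervalIntegrable_iterPrim hu 0 0 1).ae_hasDerivAt_integral
    filter_upwards [ae_restrict_of_ae h1, ae_mem_Ioo_unit] with x hx hx01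
    have hx' : x ∈ Icc (0 : ℝ) 1 := Ioo_subset_Icc_self hx01
    have h3 : HasDerivAt (iterPrim u 1) (iterPrim u 0 x) x :=
      hx (by rwa [uIcc_of_le zero_le_one]) 0 (by simp)
    have h4 := hder j le_rfl
    rw [Nat.sub_self, zero_add] at h4
    rw [iteratedDeriv_succ, h4, h3.deriv]
    exact indicator_of_mem hx' _

/-- The n conditions at 1 are continuous in the L₂ norm. Closedness makes the energy space a Hilbert
space. -/
theorem isClosed_range_topDeriv {n : ℕ} (hn : 1 < n) :
    IsClosed (LinearMap.range (topDeriv hn) : Set (Lp ℂ 2 unitMeasure)) := by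
  have : (LinearMap.range (topDeriv hn) : Set (Lp ℂ 2 unitMeasure)) =
      ⋂ i : Fin n, {u : Lp ℂ 2 unitMeasure | iterPrim u (i + 1) 1 = 0} := by
    ext u
    simp only [SetLike.mem_coe, mem_range_topDeriv_iff hn, mem_iInter]
    exact ⟨fun h i => h i i.2, fun h i hi => h ⟨i, hi⟩⟩
  rw [this]
  exact isClosed_iInter fun i => isClosed_eq (continuous_iterPrim_eval _) continuous_const

end IteratedPrimitive

/-! ### Squeezing Sobolev functions into a subinterval -/

section Shift

variable {n : ℕ} {y : ℝ → ℂ}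

theorem memLp_iteratedDeriv_volume (hn : 1 < n) (hy : y ∈ sobolevZero n) :
    MemLp (iteratedDeriv n y) 2 volume := by
  have h : iteratedDeriv n y = indicator (Icc 0 1) (iteratedDeriv n y) := by
    symm
    rw [indicator_eq_self]
    intro x hx
    by_contra h
    exact hx (iteratedDeriv_eq_zero_of_notMem hy n h)
  rw [h, memLp_indicator_iff_restrict measurableSet_Icc]
  exact memLp_iteratedDeriv hn hy

theorem integral_outside_eq_zero (hy : y ∈ sobolevZero n) (k : ℕ) {s t : ℝ}
    (hst : (s ≤ 0 ∧ t ≤ 0) ∨ (1 ≤ s ∧ 1 ≤ t)) {g : ℂ → ℂ} (hg : g 0 = 0) :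
    ∫ x in s..t, g (iteratedDeriv k y x) = 0 := by
  refine intervalIntegral.integral_zero_ae ?_
  have h0 : ∀ᵐ x : ℝ, x ≠ 0 := by simp [ae_iff]
  have h1 : ∀ᵐ x : ℝ, x ≠ 1 := by simp [ae_iff]
  filter_upwards [h0, h1] with x hx0 hx1 hx
  rw [iteratedDeriv_eq_zero_of_notMem hy k, hg]
  intro hx'
  rw [uIoc_eq_union] at hx
  rcases hst with ⟨a, b⟩ | ⟨a, b⟩
  · refine hx0 (le_antisymm ?_ hx'.1)
    rcases hx with hx | hx
    · exact hx.2.trans b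
    · exact hx.2.trans a
  · refine hx1 (le_antisymm hx'.2 ?_)
    rcases hx with hx | hx
    · exact a.trans hx.1.le
    · exact b.trans hx.1.le

theorem iteratedDeriv_eq_zero_of_le_or_ge (hy : y ∈ sobolevZero n) {k : ℕ} (hk : k < n) {x : ℝ}
    (hx : x ≤ 0 ∨ 1 ≤ x) : iteratedDeriv k y x = 0 := by
  by_cases h : x ∈ Icc (0 : ℝ) 1
  · rcases hx with hx | hx
    · rw [le_antisymm hx h.1]; exact (hy.2.2.2 k hk).1
    · rw [le_antisymm h.2 hx]; exact (hy.2.2.2 k hk).2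
  · exact iteratedDeriv_eq_zero_of_notMem hy k h

/-- The conditions at both ends keep the extension by zero absolutely continuous on the whole line;
this is needed because x ↦ p + hx may leave [0, 1]. -/
theorem iteratedDeriv_eq_integral_real (hn : 1 < n) (hy : y ∈ sobolevZero n) (x : ℝ) :
    iteratedDeriv (n - 1) y x = ∫ t in (0 : ℝ)..x, iteratedDeriv n y t := by
  have hk : n - 1 < n := by omega
  have hk1 : n - 1 + 1 = n := by omega
  have hII : ∀ s t, IntervalIntegrable (iteratedDeriv n y) volume s t := fun s t =>
    intervalIntegrable_iff.2 (((memLp_iteratedDeriv_volume hn hy).locallyIntegrable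
      (by norm_num)).integrableOn_isCompact isCompact_uIcc |>.mono_set uIoc_subset_uIcc)
  by_cases h : x ∈ Icc (0 : ℝ) 1
  · have := iteratedDeriv_eq_integral hn hy hk h
    rwa [hk1] at this
  · rw [iteratedDeriv_eq_zero_of_notMem hy _ h]
    rcases lt_or_ge x 0 with h0 | h0
    · exact (integral_outside_eq_zero hy n (Or.inl ⟨le_rfl, h0.le⟩) (g := id) rfl).symm
    · have h1 : 1 < x := by
        by_contra h1
        exact h ⟨h0, not_lt.1 h1⟩
      rw [← intervalIntegral.integral_add_adjacent_intervals (hII 0 1) (hII 1 x)]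
      have e1 := iteratedDeriv_eq_integral hn hy hk (x := 1) (by simp)
      rw [hk1, (hy.2.2.2 _ hk).2] at e1
      have e2 := integral_outside_eq_zero hy n (Or.inr ⟨le_rfl, h1.le⟩) (g := id) rfl
      simp only [id] at e2
      rw [← e1, e2, add_zero]

/-- Contractions of `[0, 1]` into itself act on the Sobolev space. -/
theorem comp_affine_mem_sobolevZero (hn : 1 < n) (hy : y ∈ sobolevZero n) {p h : ℝ} (hh : 0 < h)
    (hp : p ≤ 0) (hph : 1 ≤ p + h) : (fun x => y (p + h * x)) ∈ sobolevZero n := by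
  have hk1 : n - 1 + 1 = n := by omega
  have hII : ∀ s t, IntervalIntegrable (iteratedDeriv n y) volume s t := fun s t =>
    intervalIntegrable_iff.2 (((memLp_iteratedDeriv_volume hn hy).locallyIntegrable
      (by norm_num)).integrableOn_isCompact isCompact_uIcc |>.mono_set uIoc_subset_uIcc)
  refine ⟨fun x hx => ?_, contDiff_comp_affine hy.2.1 p h,
    ⟨fun x => ((h ^ n : ℝ) : ℂ) * iteratedDeriv n y (p + h * x), ?_, ?_⟩, fun k hk => ?_⟩
  · have := iteratedDeriv_eq_zero_of_le_or_ge hy (k := 0) (by omega) (x := p + h * x) ?_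
    · simpa using this
    · rw [mem_Icc, not_and_or, not_le, not_le] at hx
      rcases hx with hx | hx
      · left; nlinarith
      · right; nlinarith
  · refine MemLp.const_mul ?_ _
    refine MemLp.mono_measure (μ := volume) Measure.restrict_le_self ?_
    have hg := memLp_iteratedDeriv_volume hn hy
    have hmeas : AEStronglyMeasurable (fun x => iteratedDeriv n y (p + h * x)) volume := by
      have : Measurable (iteratedDeriv n y) := by
        rw [iteratedDeriv_eq_deriv hn]; exact measurable_deriv _
      exact (this.comp (by fun_prop : Measurable fun x : ℝ => p + h * x)).aestronglyMeasurable
    rw [memLp_two_iff_integrable_sq_norm hmeas]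
    have h1 := (memLp_two_iff_integrable_sq_norm hg.1).1 hg
    exact (h1.comp_add_left p).comp_mul_left' hh.ne'
  · intro x _
    rw [iteratedDeriv_comp_affine, intervalIntegral.integral_const_mul,
      intervalIntegral.integral_comp_add_mul _ hh.ne' p, mul_zero, add_zero]
    have e1 := iteratedDeriv_eq_integral_real hn hy (p + h * x)
    have e2 := integral_outside_eq_zero hy n (s := p) (t := 0) (Or.inl ⟨hp, le_rfl⟩)
      (g := id) rfl
    simp only [id] at e2
    rw [← intervalIntegral.integral_add_adjacent_intervals (hII p 0) (hII 0 _), e2, zero_add,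
      ← e1, Complex.real_smul]
    have : (h : ℂ) ≠ 0 := by exact_mod_cast hh.ne'
    have hpow : (h : ℂ) ^ n = (h : ℂ) ^ (n - 1) * h := by rw [← pow_succ, hk1]
    push_cast
    rw [hpow]
    field_simp
  · rw [iteratedDeriv_comp_affine]
    constructor
    · simp only [mul_zero, add_zero]
      rw [iteratedDeriv_eq_zero_of_le_or_ge hy hk (Or.inl hp), mul_zero]
    · simp only [mul_one]
      rw [iteratedDeriv_eq_zero_of_le_or_ge hy hk (Or.inr hph), mul_zero]

/-- An equality, since the image of [0, 1] under x ↦ p + hx covers the support of `y` and no energy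
is lost. -/
theorem norm_topDeriv_comp_affine_sq (hn : 1 < n) (hy : y ∈ sobolevZero n) {p h : ℝ} (hh : 0 < h)
    (hp : p ≤ 0) (hph : 1 ≤ p + h) :
    ‖topDeriv hn ⟨_, comp_affine_mem_sobolevZero hn hy hh hp hph⟩‖ ^ 2 =
      h ^ (2 * n - 1) * ‖topDeriv hn ⟨y, hy⟩‖ ^ 2 := by
  rw [norm_topDeriv_sq, norm_topDeriv_sq]
  simp_rw [norm_iteratedDeriv_comp_affine_sq]
  rw [intervalIntegral.integral_const_mul,
    intervalIntegral.integral_comp_add_mul (fun t => ‖iteratedDeriv n y t‖ ^ 2) hh.ne' p,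
    mul_zero, mul_one, add_zero, smul_eq_mul, ← mul_assoc]
  have hpow : h ^ (2 * n) * h⁻¹ = h ^ (2 * n - 1) := by
    have : 2 * n = (2 * n - 1) + 1 := by omega
    rw [this, pow_succ, mul_assoc, mul_inv_cancel₀ hh.ne', mul_one, Nat.add_sub_cancel]
  rw [hpow]
  congr 1
  rw [intervalIntegral.integral_of_le (by linarith), intervalIntegral.integral_of_le zero_le_one]
  refine setIntegral_eq_of_subset_of_ae_sdiff_eq_zero measurableSet_Ioc.nullMeasurableSet
    (Ioc_subset_Ioc hp hph) ?_
  have h0 : ∀ᵐ x : ℝ, x ≠ 0 := by simp [ae_iff]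
  filter_upwards [h0] with x hx0 hx
  rw [iteratedDeriv_eq_zero_of_notMem hy n, norm_zero, zero_pow two_ne_zero]
  intro hx'
  exact hx.2 ⟨lt_of_le_of_ne hx'.1 hx0.symm, hx'.2⟩

end Shift

/-! ### Bump functions in the Sobolev space -/

section Bump

theorem smooth_mem_sobolevZero {n : ℕ} (hn : 1 < n) {φ : ℝ → ℂ} (hφ : ContDiff ℝ n φ)
    {s t : ℝ} (hs : 0 < s) (ht : t < 1) (hsupp : ∀ x, x ∉ Icc s t → φ x = 0) :
    φ ∈ sobolevZero n := by
  have hk1 : n - 1 + 1 = n := by omega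
  have hzero : ∀ k x, x ∉ Icc s t → iteratedDeriv k φ x = 0 := by
    intro k x hx
    have h : φ =ᶠ[𝓝 x] fun _ => 0 := by
      filter_upwards [isClosed_Icc.isOpen_compl.mem_nhds hx] with t ht
      exact hsupp t ht
    rw [h.iteratedDeriv_eq k]
    simp
  have h0 : (0 : ℝ) ∉ Icc s t := fun h => not_lt.2 h.1 hs
  have h1 : (1 : ℝ) ∉ Icc s t := fun h => not_lt.2 h.2 ht
  have hcont : Continuous (iteratedDeriv n φ) := hφ.continuous_iteratedDeriv n le_rfl
  refine ⟨fun x hx => hsupp x fun h => hx ⟨hs.le.trans h.1, h.2.trans ht.le⟩,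
    hφ.of_le (by exact_mod_cast (by omega)), ⟨iteratedDeriv n φ, ?_, fun x _ => ?_⟩,
    fun k _ => ⟨hzero k 0 h0, hzero k 1 h1⟩⟩
  · rw [memLp_two_iff_integrable_sq_norm hcont.aestronglyMeasurable]
    exact (hcont.norm.pow 2).continuousOn.integrableOn_compact isCompact_Icc
  · have hd : ∀ t, HasDerivAt (iteratedDeriv (n - 1) φ) (iteratedDeriv n φ t) t := by
      intro t
      rw [iteratedDeriv_eq_deriv hn]
      refine ((hφ.differentiable_iteratedDeriv (n - 1) ?_) t).hasDerivAt
      exact_mod_cast (by omega)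
    rw [intervalIntegral.integral_eq_sub_of_hasDerivAt (fun t _ => hd t)
      (hcont.intervalIntegrable _ _), hzero (n - 1) 0 h0, sub_zero]

theorem exists_bump {n : ℕ} (hn : 1 < n) {K : Set ℝ} (hK : IsClosed K) {c : ℝ}
    (hc : c ∈ Ioo (0 : ℝ) 1) (hcK : c ∉ K) :
    ∃ φ ∈ sobolevZero n, φ c = 1 ∧ ∀ x ∈ K, φ x = 0 := by
  have hnhds : Kᶜ ∩ Ioo 0 1 ∈ 𝓝 c :=
    Filter.inter_mem (hK.isOpen_compl.mem_nhds hcK) (Ioo_mem_nhds hc.1 hc.2)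
  obtain ⟨r, hr, hsub⟩ := Metric.nhds_basis_closedBall.mem_iff.1 hnhds
  let b : ContDiffBump c := ⟨r / 2, r, by positivity, half_lt_self hr⟩
  have hb : ∀ x, x ∉ Metric.closedBall c r → b x = 0 := by
    intro x hx
    refine b.zero_of_le_dist ?_
    rw [Metric.mem_closedBall, not_le] at hx
    exact hx.le
  refine ⟨fun x => ((b x : ℝ) : ℂ), ?_, ?_, ?_⟩
  · have hball := Real.closedBall_eq_Icc (x := c) (r := r)
    have hl := (hsub (by rw [hball]; exact ⟨le_rfl, by linarith⟩ :
      c - r ∈ Metric.closedBall c r)).2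
    have hr' := (hsub (by rw [hball]; exact ⟨by linarith, le_rfl⟩ :
      c + r ∈ Metric.closedBall c r)).2
    refine smooth_mem_sobolevZero hn (s := c - r) (t := c + r) ?_ hl.1 hr'.2 ?_
    · exact Complex.ofRealCLM.contDiff.comp (b.contDiff (n := n))
    · intro x hx
      rw [← hball] at hx
      simp [hb x hx]
  · have : b c = 1 := b.one_of_mem_closedBall (by simp [b]; positivity)
    simp [this]
  · intro x hx
    simp [hb x fun h => (hsub h).1 hx]

end Bump

/-! ### Bounds for the form of ρ in the C¹ norm -/

section Form

/-- The product `z ȳ`. -/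
noncomputable def mulConj (y z : ℝ → ℂ) (x : ℝ) : ℂ := z x * starRingEnd ℂ (y x)

variable {N : ℕ} {a β d : ℕ → ℝ} {m : ℕ} {P : L2} {f y z w : ℝ → ℂ}

theorem contDiff_conj {k : WithTop ℕ∞} (hy : ContDiff ℝ k y) :
    ContDiff ℝ k fun x => starRingEnd ℂ (y x) :=
  Complex.conjCLE.contDiff.comp hy

theorem contDiff_mulConj {k : WithTop ℕ∞} (hy : ContDiff ℝ k y) (hz : ContDiff ℝ k z) :
    ContDiff ℝ k (mulConj y z) :=
  hz.mul (contDiff_conj hy)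

theorem deriv_mulConj (hy : ContDiff ℝ 1 y) (hz : ContDiff ℝ 1 z) (x : ℝ) :
    deriv (mulConj y z) x = deriv z x * starRingEnd ℂ (y x) + z x * starRingEnd ℂ (deriv y x) := by
  have h1 : HasDerivAt z (deriv z x) x := (hz.differentiable (by norm_num) x).hasDerivAt
  have h2 : HasDerivAt (fun x => starRingEnd ℂ (y x)) (starRingEnd ℂ (deriv y x)) x :=
    ((hy.differentiable (by norm_num) x).hasDerivAt).star
  exact (h1.mul h2).deriv

/-- A bound for the form `massForm` in terms of the `C¹` norms. -/
noncomputable def massBound (N : ℕ) (β : ℕ → ℝ) (P : L2) : ℝ :=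
  2 * (∫ x in (0 : ℝ)..1, ‖(P : ℝ → ℝ) x‖) + |β N| + |β 1| + 1

/-- The summand 1 in `massBound` serves only this strict positivity; the bound is later divided by.
-/
theorem massBound_pos (N : ℕ) (β : ℕ → ℝ) (P : L2) : 0 < massBound N β P := by
  unfold massBound
  have : 0 ≤ ∫ x in (0 : ℝ)..1, ‖(P : ℝ → ℝ) x‖ :=
    intervalIntegral.integral_nonneg zero_le_one fun x _ => norm_nonneg _
  positivity

/-- The factor 2 in the derivative bound is for products: (z ȳ)' has two terms, each at most the
product of the C¹ bounds. -/
theorem norm_massForm_le {K : ℝ} (hf : ∀ x ∈ Icc (0 : ℝ) 1, ‖f x‖ ≤ K)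
    (hd : ∀ x ∈ Icc (0 : ℝ) 1, ‖deriv f x‖ ≤ 2 * K) :
    ‖massForm N β P f‖ ≤ massBound N β P * K := by
  have hK : 0 ≤ K := (norm_nonneg _).trans (hf 0 (by simp))
  have h1 : ‖∫ x in (0 : ℝ)..1, (((P : ℝ → ℝ) x : ℝ) : ℂ) * deriv f x‖ ≤
      ∫ x in (0 : ℝ)..1, ‖(P : ℝ → ℝ) x‖ * (2 * K) := by
    refine intervalIntegral.norm_integral_le_of_norm_le zero_le_one
      (Eventually.of_forall fun x hx => ?_) ?_
    · rw [norm_mul, Complex.norm_real]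
      exact mul_le_mul_of_nonneg_left (hd x ⟨hx.1.le, hx.2⟩) (norm_nonneg _)
    · exact (intervalIntegrable_of_memLp (Lp.memLp P) (by simp) (by simp)).norm.mul_const _
  rw [intervalIntegral.integral_mul_const] at h1
  have h2 : ‖(β N : ℂ) * f 1‖ ≤ |β N| * K := by
    rw [norm_mul, Complex.norm_real, Real.norm_eq_abs]
    exact mul_le_mul_of_nonneg_left (hf 1 (by simp)) (abs_nonneg _)
  have h3 : ‖(β 1 : ℂ) * f 0‖ ≤ |β 1| * K := by
    rw [norm_mul, Complex.norm_real, Real.norm_eq_abs]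
    exact mul_le_mul_of_nonneg_left (hf 0 (by simp)) (abs_nonneg _)
  unfold massForm massBound
  refine (norm_sub_le _ _).trans ?_
  have h4 := norm_add_le (-∫ x in (0 : ℝ)..1, (((P : ℝ → ℝ) x : ℝ) : ℂ) * deriv f x)
    ((β N : ℂ) * f 1)
  rw [norm_neg] at h4
  linarith

theorem norm_massForm_mulConj_le (hy : ContDiff ℝ 1 y) (hz : ContDiff ℝ 1 z) {K M : ℝ}
    (hyK : ∀ k < 2, ∀ x ∈ Icc (0 : ℝ) 1, ‖iteratedDeriv k y x‖ ≤ K)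
    (hzM : ∀ k < 2, ∀ x ∈ Icc (0 : ℝ) 1, ‖iteratedDeriv k z x‖ ≤ M) :
    ‖massForm N β P (mulConj y z)‖ ≤ massBound N β P * (K * M) := by
  have hy0 : ∀ x ∈ Icc (0 : ℝ) 1, ‖y x‖ ≤ K := by simpa using hyK 0 (by norm_num)
  have hz0 : ∀ x ∈ Icc (0 : ℝ) 1, ‖z x‖ ≤ M := by simpa using hzM 0 (by norm_num)
  have hy1 : ∀ x ∈ Icc (0 : ℝ) 1, ‖deriv y x‖ ≤ K := by simpa using hyK 1 (by norm_num)
  have hz1 : ∀ x ∈ Icc (0 : ℝ) 1, ‖deriv z x‖ ≤ M := by simpa using hzM 1 (by norm_num)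
  have hK : 0 ≤ K := (norm_nonneg _).trans (hy0 0 (by simp))
  have hM : 0 ≤ M := (norm_nonneg _).trans (hz0 0 (by simp))
  refine norm_massForm_le (fun x hx => ?_) fun x hx => ?_
  · unfold mulConj
    rw [norm_mul, RCLike.norm_conj, mul_comm]
    exact mul_le_mul (hy0 x hx) (hz0 x hx) (norm_nonneg _) hK
  · rw [deriv_mulConj hy hz]
    refine (norm_add_le _ _).trans ?_
    rw [norm_mul, norm_mul, RCLike.norm_conj, RCLike.norm_conj]
    have h1 := mul_le_mul (hy0 x hx) (hz1 x hx) (norm_nonneg _) hK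
    have h2 := mul_le_mul (hy1 x hx) (hz0 x hx) (norm_nonneg _) hK
    linarith

theorem mulConj_add_right (y z w : ℝ → ℂ) : mulConj y (z + w) = mulConj y z + mulConj y w := by
  ext x; simp [mulConj, add_mul]

theorem mulConj_add_left (y z w : ℝ → ℂ) : mulConj (y + z) w = mulConj y w + mulConj z w := by
  ext x; simp [mulConj, mul_add]

theorem mulConj_smul_right (c : ℂ) (y z : ℝ → ℂ) : mulConj y (c • z) = c • mulConj y z := by
  ext x; simp [mulConj, mul_assoc]

theorem mulConj_smul_left (c : ℂ) (y z : ℝ → ℂ) :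
    mulConj (c • y) z = starRingEnd ℂ c • mulConj y z := by
  ext x; simp [mulConj, mul_left_comm]

theorem massForm_mulConj_swap (y z : ℝ → ℂ) :
    massForm N β P (mulConj z y) = starRingEnd ℂ (massForm N β P (mulConj y z)) := by
  rw [← massForm_conj]
  congr 1
  ext x
  simp [mulConj, mul_comm]

end Form

/-! ### The operator of the pencil on the energy space -/

section Operator

variable {n : ℕ}

/-- The Hilbert space of the `n`-th derivatives of the elements of the Sobolev space. -/
def EnergySpace (hn : 1 < n) : Type := LinearMap.range (topDeriv hn)

noncomputable instance (hn : 1 < n) : NormedAddCommGroup (EnergySpace hn) :=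
  inferInstanceAs (NormedAddCommGroup (LinearMap.range (topDeriv hn)))

noncomputable instance (hn : 1 < n) : InnerProductSpace ℂ (EnergySpace hn) :=
  inferInstanceAs (InnerProductSpace ℂ (LinearMap.range (topDeriv hn)))

instance (hn : 1 < n) : CompleteSpace (EnergySpace hn) :=
  (isClosed_range_topDeriv hn).completeSpace_coe

/-- The identification of the Sobolev space with the space of `n`-th derivatives. -/
noncomputable def sobolevEquiv (hn : 1 < n) : sobolevZero n ≃ₗ[ℂ] EnergySpace hn :=
  LinearEquiv.ofInjective (topDeriv hn) (topDeriv_injective hn)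

/-- The function with a given `n`-th derivative. -/
noncomputable def rep (hn : 1 < n) (u : EnergySpace hn) : ℝ → ℂ := ((sobolevEquiv hn).symm u).1

theorem rep_mem (hn : 1 < n) (u : EnergySpace hn) : rep hn u ∈ sobolevZero n :=
  ((sobolevEquiv hn).symm u).2

theorem rep_sobolevEquiv (hn : 1 < n) (y : sobolevZero n) : rep hn (sobolevEquiv hn y) = y.1 := by
  unfold rep; rw [LinearEquiv.symm_apply_apply]

theorem topDeriv_rep (hn : 1 < n) (u : EnergySpace hn) :
    topDeriv hn ⟨rep hn u, rep_mem hn u⟩ = Subtype.val u :=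
  congrArg Subtype.val ((sobolevEquiv hn).apply_symm_apply u)

theorem norm_topDeriv_rep (hn : 1 < n) (u : EnergySpace hn) :
    ‖topDeriv hn ⟨rep hn u, rep_mem hn u⟩‖ = ‖u‖ := by
  rw [topDeriv_rep]; rfl

theorem rep_add (hn : 1 < n) (u v : EnergySpace hn) : rep hn (u + v) = rep hn u + rep hn v := by
  unfold rep; rw [map_add]; rfl

theorem rep_smul (hn : 1 < n) (c : ℂ) (u : EnergySpace hn) : rep hn (c • u) = c • rep hn u := by
  unfold rep; rw [map_smul]; rfl

theorem contDiff_rep (hn : 1 < n) (u : EnergySpace hn) : ContDiff ℝ 1 (rep hn u) :=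
  contDiff_one hn (rep_mem hn u)

theorem norm_iteratedDeriv_rep_le (hn : 1 < n) (u : EnergySpace hn) {k : ℕ} (hk : k < n) {x : ℝ}
    (hx : x ∈ Icc (0 : ℝ) 1) : ‖iteratedDeriv k (rep hn u) x‖ ≤ ‖u‖ := by
  rw [← norm_topDeriv_rep hn u]
  exact norm_iteratedDeriv_le_topDeriv hn ⟨rep hn u, rep_mem hn u⟩ hk hx

variable (N : ℕ) (β : ℕ → ℝ) (P : L2)

/-- The form `(y, z) ↦ ∫ ρ z ȳ` on the space of `n`-th derivatives. -/
noncomputable def massSesq (hn : 1 < n) : EnergySpace hn →ₗ⋆[ℂ] EnergySpace hn →ₗ[ℂ] ℂ :=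
  LinearMap.mk₂'ₛₗ (starRingEnd ℂ) (RingHom.id ℂ)
    (fun u v => massForm N β P (mulConj (rep hn u) (rep hn v)))
    (fun u v w => by
      rw [rep_add, mulConj_add_left, massForm_add (contDiff_mulConj (contDiff_rep hn _)
        (contDiff_rep hn _)) (contDiff_mulConj (contDiff_rep hn _) (contDiff_rep hn _))])
    (fun c u v => by rw [rep_smul, mulConj_smul_left, massForm_smul, smul_eq_mul])
    (fun u v w => by
      rw [rep_add, mulConj_add_right, massForm_add (contDiff_mulConj (contDiff_rep hn _)
        (contDiff_rep hn _)) (contDiff_mulConj (contDiff_rep hn _) (contDiff_rep hn _))])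
    (fun c u v => by rw [rep_smul, mulConj_smul_right, massForm_smul, smul_eq_mul]; rfl)

theorem norm_massSesq_le (hn : 1 < n) (u v : EnergySpace hn) :
    ‖massSesq N β P hn u v‖ ≤ massBound N β P * ‖u‖ * ‖v‖ := by
  rw [mul_assoc]
  exact norm_massForm_mulConj_le (contDiff_rep hn u) (contDiff_rep hn v)
    (fun k hk x hx => norm_iteratedDeriv_rep_le hn u (by omega) hx)
    (fun k hk x hx => norm_iteratedDeriv_rep_le hn v (by omega) hx)

/-- The operator of multiplication by `ρ = P'` in the energy space. -/
noncomputable def massOp (hn : 1 < n) : EnergySpace hn →L[ℂ] EnergySpace hn :=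
  InnerProductSpace.continuousLinearMapOfBilin
    ((massSesq N β P hn).mkContinuous₂ (massBound N β P) (norm_massSesq_le N β P hn))

local notation "⟪" x "," y "⟫" => inner ℂ x y

theorem inner_massOp (hn : 1 < n) (u v : EnergySpace hn) :
    ⟪massOp N β P hn u, v⟫ = massForm N β P (mulConj (rep hn u) (rep hn v)) := by
  unfold massOp
  rw [InnerProductSpace.continuousLinearMapOfBilin_apply, LinearMap.mkContinuous₂_apply]
  rfl

theorem massOp_isSymmetric (hn : 1 < n) :
    (massOp N β P hn : EnergySpace hn →ₗ[ℂ] EnergySpace hn).IsSymmetric := by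
  intro u v
  change ⟪massOp N β P hn u, v⟫ = ⟪u, massOp N β P hn v⟫
  rw [← inner_conj_symm u, inner_massOp, inner_massOp, massForm_mulConj_swap]

/-- On Sobolev functions the boundary terms of `massForm` vanish, so it is exactly -∫ P (y z̄)', and
the weak problem becomes (I - λA)u = 0. -/
theorem pencilForm_rep (hn : 1 < n) (lam : ℂ) (u v : EnergySpace hn) :
    pencilForm n P lam (rep hn u) (rep hn v) = ⟪v, u - lam • massOp N β P hn u⟫ := by
  have h1 : ⟪v, massOp N β P hn u⟫ = massForm N β P (mulConj (rep hn v) (rep hn u)) := by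
    exact (massOp_isSymmetric N β P hn v u).symm.trans (inner_massOp N β P hn v u)
  have h2 : ⟪v, u⟫ = ∫ x in (0 : ℝ)..1, iteratedDeriv n (rep hn u) x *
      starRingEnd ℂ (iteratedDeriv n (rep hn v) x) := by
    have := inner_topDeriv hn ⟨rep hn u, rep_mem hn u⟩ ⟨rep hn v, rep_mem hn v⟩
    rw [topDeriv_rep, topDeriv_rep] at this
    exact this
  have h3 : massForm N β P (mulConj (rep hn v) (rep hn u)) =
      -∫ x in (0 : ℝ)..1, (((P : ℝ → ℝ) x : ℝ) : ℂ) * deriv (mulConj (rep hn v) (rep hn u)) x := by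
    unfold massForm
    simp [mulConj, eval_zero hn (rep_mem hn v), eval_one hn (rep_mem hn v)]
  have h4 : ⟪v, lam • massOp N β P hn u⟫ = lam * ⟪v, massOp N β P hn u⟫ :=
    inner_smul_right _ _ _
  rw [inner_sub_right, h4, h1, h2, h3, mul_neg, sub_neg_eq_add,
    ← intervalIntegral.integral_const_mul, ← intervalIntegral.integral_add]
  · unfold pencilForm
    refine intervalIntegral.integral_congr fun x _ => ?_
    simp only [mul_assoc]
    rfl
  · have := integrand_integrable (P := P) (lam := 0) hn (rep_mem hn u) (rep_mem hn v)
    simpa using this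
  · exact (intervalIntegrable_P_mul P (contDiff_mulConj (contDiff_rep hn v) (contDiff_rep hn u))
      (by simp) (by simp)).const_mul _

/-- Taking n-th derivatives carries weak solutions for λ = -x to the kernel of I + xA, that is, to
the eigenspace of A for -1/x. -/
theorem eigenspace_eq_map (hn : 1 < n) {x : ℝ} (hx : x ≠ 0) :
    eigenspace hn P ((-x : ℝ) : ℂ) =
      (((negEigenspace (massOp N β P hn) x).map
        ((sobolevEquiv hn).symm : EnergySpace hn →ₗ[ℂ] sobolevZero n)).map
          (sobolevZero n).subtype) := by
  have hx' : (x : ℂ) ≠ 0 := by exact_mod_cast hx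
  have key : ∀ u : EnergySpace hn, u ∈ negEigenspace (massOp N β P hn) x ↔
      u - ((-x : ℝ) : ℂ) • massOp N β P hn u = 0 := by
    intro u
    have : u ∈ negEigenspace (massOp N β P hn) x ↔
      massOp N β P hn u = ((-x⁻¹ : ℝ) : ℂ) • u := Module.End.mem_eigenspace_iff
    rw [this, sub_eq_zero]
    constructor
    · intro h
      rw [h, smul_smul]
      push_cast
      rw [neg_mul_neg, mul_inv_cancel₀ hx', one_smul]
    · intro h
      conv_rhs => rw [h]
      rw [smul_smul]
      push_cast
      rw [neg_mul_neg, inv_mul_cancel₀ hx', one_smul]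
  ext y
  constructor
  · rintro ⟨hy, hy'⟩
    refine ⟨⟨y, hy⟩, ⟨sobolevEquiv hn ⟨y, hy⟩, ?_, (sobolevEquiv hn).symm_apply_apply _⟩, rfl⟩
    rw [SetLike.mem_coe, key]
    refine ext_inner_left ℂ fun v => ?_
    rw [← pencilForm_rep, rep_sobolevEquiv, inner_zero_right]
    exact hy' _ (rep_mem hn v)
  · rintro ⟨_, ⟨u, hu, rfl⟩, rfl⟩
    refine ⟨rep_mem hn u, fun z hz => ?_⟩
    have h1 := pencilForm_rep N β P hn ((-x : ℝ) : ℂ) u (sobolevEquiv hn ⟨z, hz⟩)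
    rw [(key u).1 hu, inner_zero_right, rep_sobolevEquiv] at h1
    exact h1

theorem finrank_eigenspace_eq (hn : 1 < n) {x : ℝ} (hx : x ≠ 0) :
    Module.finrank ℂ (eigenspace hn P ((-x : ℝ) : ℂ)) =
      Module.finrank ℂ (negEigenspace (massOp N β P hn) x) := by
  rw [eigenspace_eq_map N β P hn hx, Submodule.finrank_map_subtype_eq]
  exact LinearEquiv.finrank_map_eq _ _

end Operator

/-! ### Compactness and the codimension bound -/

section Asymptotics

variable {n N : ℕ} {a β d : ℕ → ℝ} {m : ℕ} {P : L2}

local notation "⟪" x "," y "⟫" => inner ℂ x y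

/-- Evaluation of a derivative of order less than `n` at a point of `[0, 1]`. -/
noncomputable def evalDeriv (hn : 1 < n) {i : ℕ} (hi : i < n) {x : ℝ} (hx : x ∈ Icc (0 : ℝ) 1) :
    EnergySpace hn →L[ℂ] ℂ :=
  LinearMap.mkContinuous
    { toFun := fun u => iteratedDeriv i (rep hn u) x
      map_add' := fun u v => by
        have h : ∀ w, ContDiffAt ℝ i (rep hn w) x := fun w =>
          ((rep_mem hn w).2.1.of_le (by exact_mod_cast (by omega : i ≤ n - 1))).contDiffAt
        rw [rep_add, iteratedDeriv_add (h u) (h v)]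
      map_smul' := fun c u => by
        have h : ContDiffAt ℝ i (rep hn u) x :=
          ((rep_mem hn u).2.1.of_le (by exact_mod_cast (by omega : i ≤ n - 1))).contDiffAt
        rw [rep_smul, iteratedDeriv_const_smul h]; rfl }
    1 fun u => by
      rw [one_mul]; exact norm_iteratedDeriv_rep_le hn u hi hx

/-- The evaluations at points remove the atoms indexed by `S` in the first `k` generations; the n
conditions at the left end of S^k[0, 1] make the remainder on that nested piece small. All indices
are used for compactness, only the negative ones for the lower bound. -/
theorem exists_sampling (hP : IsZeroSpectralOrder N a β d m P) (hn : 1 < n) (k : ℕ)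
    {S : Finset ℕ} (hS : S ⊆ Finset.Icc 1 (N - 1)) :
    ∃ F : EnergySpace hn →L[ℂ] (((Fin k × S) ⊕ Fin n) → ℂ), ∀ u, F u = 0 →
      (∀ j < k, ∀ i ∈ S, rep hn u ((shrink a m)^[j] (node a i)) = 0) ∧
      ∀ i < n, iteratedDeriv i (rep hn u) ((shrink a m)^[k] 0) = 0 := by
  have hnode : ∀ i ∈ S, node a i ∈ Icc (0 : ℝ) 1 := fun i hi =>
    hP.node_mem (by have := Finset.mem_Icc.1 (hS hi); omega)
  refine ⟨ContinuousLinearMap.pi (fun p => p.elim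
    (fun p => evalDeriv hn (by omega : 0 < n) (hP.shrink_iterate_mem p.1 (hnode p.2 p.2.2)))
    (fun i => evalDeriv hn i.2 (hP.shrink_iterate_mem k (x := 0) (by simp)))), fun u hu => ⟨?_, ?_⟩⟩
  · intro j hj i hi
    have := congrFun hu (Sum.inl (⟨j, hj⟩, ⟨i, hi⟩))
    have h2 : iteratedDeriv 0 (rep hn u) ((shrink a m)^[j] (node a i)) = 0 := this
    rwa [iteratedDeriv_zero] at h2
  · intro i hi
    exact congrFun hu (Sum.inr ⟨i, hi⟩)

/-- With vanishing derivatives at the left end of S^k[0, 1], each rescaled function has derivatives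
of orders 0 and 1 bounded by a_m^(k(2n-1)/2) times its energy norm; two factors enter the product.
-/
theorem norm_massForm_tail_le (hP : IsZeroSpectralOrder N a β d m P) (hn : 1 < n) (k : ℕ)
    {u v : EnergySpace hn} (hu : ∀ i < n, iteratedDeriv i (rep hn u) ((shrink a m)^[k] 0) = 0)
    (hv : ∀ i < n, iteratedDeriv i (rep hn v) ((shrink a m)^[k] 0) = 0) :
    ‖massForm N β P (fun x => mulConj (rep hn u) (rep hn v) ((shrink a m)^[k] x))‖ ≤
      massBound N β P * (a m ^ (2 * n - 1)) ^ k * ‖u‖ * ‖v‖ := by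
  have ha : 0 < a m := hP.a_pos m hP.m_mem
  set p := (shrink a m)^[k] 0 with hp
  set h := a m ^ k with hh
  have hh0 : 0 < h := by positivity
  have heq : (fun x => mulConj (rep hn u) (rep hn v) ((shrink a m)^[k] x)) =
      mulConj (fun x => rep hn u (p + h * x)) (fun x => rep hn v (p + h * x)) := by
    funext x
    rw [shrink_iterate]
    rfl
  have hp0 : 0 ≤ p := (hP.shrink_iterate_mem k (x := 0) (by simp)).1
  have hp1 : p + h ≤ 1 := by
    have := (hP.shrink_iterate_mem k (x := 1) (by simp)).2
    rwa [shrink_iterate, mul_one] at this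
  have hb : ∀ w : EnergySpace hn, (∀ i < n, iteratedDeriv i (rep hn w) p = 0) → ∀ i < 2,
      ∀ x ∈ Icc (0 : ℝ) 1, ‖iteratedDeriv i (fun x => rep hn w (p + h * x)) x‖ ≤
        Real.sqrt (h ^ (2 * n - 1)) * ‖w‖ := by
    intro w hw i hi x hx
    rw [← norm_topDeriv_rep hn w]
    exact norm_iteratedDeriv_comp_affine_le hn ⟨rep hn w, rep_mem hn w⟩ hp0 hh0 hp1 hw
      (by omega) hx
  rw [heq]
  refine (norm_massForm_mulConj_le (contDiff_comp_affine (contDiff_rep hn u) p h)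
    (contDiff_comp_affine (contDiff_rep hn v) p h) (hb u hu) (hb v hv)).trans_eq ?_
  have hs : Real.sqrt (h ^ (2 * n - 1)) * Real.sqrt (h ^ (2 * n - 1)) =
      (a m ^ (2 * n - 1)) ^ k := by
    rw [Real.mul_self_sqrt (by positivity), hh, ← pow_mul, ← pow_mul, mul_comm]
  rw [← hs]
  ring

theorem IsZeroSpectralOrder.massForm_rep_eq (hP : IsZeroSpectralOrder N a β d m P) (hn : 1 < n)
    (u v : EnergySpace hn) (k : ℕ) :
    massForm N β P (mulConj (rep hn u) (rep hn v)) =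
      ∑ j ∈ Finset.range k, (d m : ℂ) ^ j * ∑ i ∈ Finset.Icc 1 (N - 1), (zeta N β d m i : ℂ) *
        mulConj (rep hn u) (rep hn v) ((shrink a m)^[j] (node a i)) +
      (d m : ℂ) ^ k *
        massForm N β P (fun x => mulConj (rep hn u) (rep hn v) ((shrink a m)^[k] x)) :=
  hP.massForm_eq_iterate (contDiff_mulConj (contDiff_rep hn u) (contDiff_rep hn v))
    (fun _ => by simp [mulConj, eval_zero hn (rep_mem hn u)])
    (fun _ => by simp [mulConj, eval_one hn (rep_mem hn u)]) k

theorem IsZeroSpectralOrder.ratio_pos (hP : IsZeroSpectralOrder N a β d m P) (hd : 0 < d m) :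
    0 < a m ^ (2 * n - 1) * d m :=
  mul_pos (pow_pos (hP.a_pos m hP.m_mem) _) hd

/-- From a_m d_m² < 1 (contraction) and a_m ≤ 1 follows (a_m d_m)² < 1, and a_m^(2n-1) ≤ a_m. -/
theorem IsZeroSpectralOrder.ratio_lt_one (hP : IsZeroSpectralOrder N a β d m P) (hn : 1 < n)
    (hd : 0 < d m) : a m ^ (2 * n - 1) * d m < 1 := by
  have ha := hP.a_pos m hP.m_mem
  have h1 : a m * d m ^ 2 < 1 := by
    refine lt_of_le_of_lt ?_ hP.contraction
    have := Finset.single_le_sum (f := fun k => a k * |d k| ^ 2)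
      (fun k hk => mul_nonneg (hP.a_pos k hk).le (by positivity)) hP.m_mem
    simpa using this
  have h2 : a m ≤ 1 := by
    rw [← hP.sum_a]
    exact Finset.single_le_sum (f := a) (fun k hk => (hP.a_pos k hk).le) hP.m_mem
  have h3 : a m ^ (2 * n - 1) ≤ a m := by
    calc a m ^ (2 * n - 1) ≤ a m ^ 1 := pow_le_pow_of_le_one ha.le h2 (by omega)
      _ = a m := pow_one _
  have h4 : a m ^ (2 * n - 1) * d m ≤ a m * d m := mul_le_mul_of_nonneg_right h3 hd.le
  have h5 : (a m * d m) ^ 2 < 1 := by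
    calc (a m * d m) ^ 2 = a m * (a m * d m ^ 2) := by ring
      _ < a m * 1 := mul_lt_mul_of_pos_left h1 ha
      _ ≤ 1 := by linarith
  have h6 : a m * d m < 1 := by
    by_contra h
    push Not at h
    nlinarith
  linarith

/-- Once all atoms of the first `k` generations are sampled away, only the remainder is left, of
size a constant times q^k. -/
theorem massOp_isCompact (hP : IsZeroSpectralOrder N a β d m P) (hn : 1 < n) (hd : 0 < d m) :
    IsCompactOperator (massOp N β P hn) := by
  refine isCompactOperator_of_form_small fun ε hε => ?_
  have hC := massBound_pos N β P
  obtain ⟨k, hk⟩ := exists_pow_lt_of_lt_one (show 0 < ε / massBound N β P by positivity)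
    (hP.ratio_lt_one hn hd)
  obtain ⟨F, hF⟩ := exists_sampling hP hn k (Finset.Subset.refl _)
  refine ⟨_, inferInstance, F, fun u v hu hv => ?_⟩
  obtain ⟨hu1, hu2⟩ := hF u hu
  obtain ⟨-, hv2⟩ := hF v hv
  rw [inner_massOp, hP.massForm_rep_eq hn u v k, Finset.sum_eq_zero, zero_add, norm_mul, norm_pow,
    Complex.norm_real, Real.norm_eq_abs, abs_of_pos hd]
  · have h1 := norm_massForm_tail_le hP hn k hu2 hv2
    have h2 : massBound N β P * (a m ^ (2 * n - 1) * d m) ^ k ≤ ε := by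
      rw [lt_div_iff₀ hC] at hk
      linarith
    calc d m ^ k * _ ≤ d m ^ k * (massBound N β P * (a m ^ (2 * n - 1)) ^ k * ‖u‖ * ‖v‖) :=
          mul_le_mul_of_nonneg_left h1 (by positivity)
      _ = massBound N β P * (a m ^ (2 * n - 1) * d m) ^ k * (‖u‖ * ‖v‖) := by
          rw [mul_pow]; ring
      _ ≤ ε * (‖u‖ * ‖v‖) := mul_le_mul_of_nonneg_right h2 (by positivity)
      _ = ε * ‖u‖ * ‖v‖ := by ring
  · intro j hj
    rw [Finset.sum_eq_zero, mul_zero]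
    intro i hi
    rw [mulConj, hu1 j (Finset.mem_range.1 hj) i hi]
    simp

/-- The indices of the negative atoms of a single generation. -/
noncomputable def negIndices (N : ℕ) (β d : ℕ → ℝ) (m : ℕ) : Finset ℕ :=
  (Finset.Icc 1 (N - 1)).filter fun k => zeta N β d m k < 0

/-- It suffices to remove the negative atoms: since d_m > 0, the other atoms of the first `k`
generations contribute nonnegatively, and the remainder is at least -const · q^k ‖u‖². -/
theorem massOp_lower_bound (hP : IsZeroSpectralOrder N a β d m P) (hn : 1 < n) (hd : 0 < d m)
    (k : ℕ) : ∃ (ι : Type) (_ : Fintype ι) (F : EnergySpace hn →ₗ[ℂ] (ι → ℂ)),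
      Fintype.card ι ≤ k * Zneg N β d m + n ∧ ∀ u, F u = 0 →
        -(massBound N β P * (a m ^ (2 * n - 1) * d m) ^ k) * ‖u‖ ^ 2 ≤
          (⟪massOp N β P hn u, u⟫).re := by
  obtain ⟨F, hF⟩ := exists_sampling hP hn k (S := negIndices N β d m) (Finset.filter_subset _ _)
  refine ⟨_, inferInstance, F.toLinearMap, ?_, fun u hu => ?_⟩
  · rw [← Nat.card_eq_fintype_card]
    rw [Nat.card_sum, Nat.card_prod, Nat.card_eq_fintype_card (α := negIndices N β d m),
      Fintype.card_coe, Nat.card_fin, Nat.card_fin]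
    exact le_rfl
  · obtain ⟨hu1, hu2⟩ := hF u hu
    rw [inner_massOp, hP.massForm_rep_eq hn u u k, Complex.add_re, Complex.re_sum]
    have h1 : ∀ x, mulConj (rep hn u) (rep hn u) x = ((‖rep hn u x‖ ^ 2 : ℝ) : ℂ) := by
      intro x
      rw [mulConj, Complex.mul_conj, Complex.normSq_eq_norm_sq]
    have h2 : 0 ≤ ∑ j ∈ Finset.range k, ((d m : ℂ) ^ j * ∑ i ∈ Finset.Icc 1 (N - 1),
        (zeta N β d m i : ℂ) *
          mulConj (rep hn u) (rep hn u) ((shrink a m)^[j] (node a i))).re := by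
      refine Finset.sum_nonneg fun j hj => ?_
      rw [← Complex.ofReal_pow, Complex.re_ofReal_mul, Complex.re_sum]
      refine mul_nonneg (by positivity) (Finset.sum_nonneg fun i hi => ?_)
      rw [h1, Complex.re_ofReal_mul, Complex.ofReal_re]
      by_cases hz : zeta N β d m i < 0
      · rw [hu1 j (Finset.mem_range.1 hj) i (Finset.mem_filter.2 ⟨hi, hz⟩)]
        simp
      · exact mul_nonneg (not_lt.1 hz) (by positivity)
    have h3 : -(massBound N β P * (a m ^ (2 * n - 1) * d m) ^ k) * ‖u‖ ^ 2 ≤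
        ((d m : ℂ) ^ k *
          massForm N β P fun x => mulConj (rep hn u) (rep hn u) ((shrink a m)^[k] x)).re := by
      have h4 := norm_massForm_tail_le hP hn k hu2 hu2
      have h5 := (abs_le.1 (Complex.abs_re_le_norm
        (massForm N β P fun x => mulConj (rep hn u) (rep hn u) ((shrink a m)^[k] x)))).1
      rw [← Complex.ofReal_pow, Complex.re_ofReal_mul]
      calc _ = d m ^ k * -(massBound N β P * (a m ^ (2 * n - 1)) ^ k * ‖u‖ * ‖u‖) := by
            rw [mul_pow]; ring
        _ ≤ _ := mul_le_mul_of_nonneg_left (by linarith) (by positivity)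
    linarith

/-! ### Test functions and the shift into the m-th piece -/

section Construction

theorem IsZeroSpectralOrder.node_eq_shrink (hP : IsZeroSpectralOrder N a β d m P) {k : ℕ}
    (hk : k ≤ N) {t : ℝ} (ht : t ∈ Icc (0 : ℝ) 1) (h : node a k = shrink a m t) :
    (t = 0 ∧ k = m - 1) ∨ (t = 1 ∧ k = m) := by
  have hm := Finset.mem_Icc.1 hP.m_mem
  have ha := hP.a_pos m hP.m_mem
  have hmem := hP.shrink_mem ht
  rw [← h] at hmem
  have hadd := node_sub_one_add a hm.1
  rcases lt_trichotomy k (m - 1) with h1 | h1 | h1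
  · exact absurd (hP.node_lt h1 (by omega)) (not_lt.2 hmem.1)
  · left
    refine ⟨?_, h1⟩
    rw [h1, shrink] at h
    have : a m * t = 0 := by linarith
    exact (mul_eq_zero.1 this).resolve_left ha.ne'
  · rcases (show m ≤ k by omega).eq_or_lt with h2 | h2
    · right
      refine ⟨?_, h2.symm⟩
      rw [← h2, shrink, ← hadd] at h
      have : a m * (t - 1) = 0 := by linarith
      linarith [(mul_eq_zero.1 this).resolve_left ha.ne']
    · exact absurd (hP.node_lt h2 hk) (not_lt.2 hmem.2)

theorem IsZeroSpectralOrder.node_mem_Ioo (hP : IsZeroSpectralOrder N a β d m P) {k : ℕ}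
    (hk : k ∈ Finset.Icc 1 (N - 1)) : node a k ∈ Ioo (0 : ℝ) 1 := by
  have hk := Finset.mem_Icc.1 hk
  refine ⟨?_, ?_⟩
  · rw [← node_zero a]; exact hP.node_lt (by omega) (by omega)
  · rw [← hP.node_last]; exact hP.node_lt (by omega) le_rfl

/-- A test function that interacts with a single atom of `ρ`. -/
theorem exists_test_function (hP : IsZeroSpectralOrder N a β d m P) (hn : 1 < n) {k : ℕ}
    (hk : k ∈ Finset.Icc 1 (N - 1)) :
    ∃ φ ∈ sobolevZero n, φ (node a k) = 1 ∧
      (∀ j ∈ Finset.Icc 1 (N - 1), j ≠ k → φ (node a j) = 0) ∧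
      ∀ g : ℝ → ℂ, ContDiff ℝ 1 g →
        massForm N β P (mulConj g φ) = zeta N β d m k * starRingEnd ℂ (g (node a k)) := by
  have hm := Finset.mem_Icc.1 hP.m_mem
  have hk' := Finset.mem_Icc.1 hk
  have hkI := hP.node_mem_Ioo hk
  have hcont : Continuous (shrink a m) := by unfold shrink; fun_prop
  -- Excluding all of S[0, 1] is not possible: α_(m-1) and α_m are its ends. So ρ is unfolded twice,
  -- and `K` consists of the other nodes, the atoms of the next generation and S²[0, 1], which
  -- contains no inner node.
  let K : Set ℝ := (node a '' ((Finset.range (N + 1)).erase k : Finset ℕ)) ∪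
    ((fun j => shrink a m (node a j)) '' (Finset.Icc 1 (N - 1) : Finset ℕ)) ∪
    ((fun x => shrink a m (shrink a m x)) '' Icc 0 1)
  have hKc : IsClosed K := by
    refine IsClosed.union (IsClosed.union ?_ ?_) ?_
    · exact ((Finset.finite_toSet _).image _).isClosed
    · exact ((Finset.finite_toSet _).image _).isClosed
    · exact (isCompact_Icc.image (hcont.comp hcont)).isClosed
  have hinj : ∀ j ≤ N, node a j = node a k → j = k := by
    intro j hj h
    rcases lt_trichotomy j k with h1 | h1 | h1
    · exact absurd h (hP.node_lt h1 (by omega)).ne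
    · exact h1
    · exact absurd h (hP.node_lt h1 hj).ne'
  have hkK : node a k ∉ K := by
    rintro ((⟨j, hj, h⟩ | ⟨j, hj, h⟩) | ⟨x, hx, h⟩)
    · have hj := Finset.mem_erase.1 (Finset.mem_coe.1 hj)
      exact hj.1 (hinj j (by have := Finset.mem_range.1 hj.2; omega) h)
    · have hjI := hP.node_mem_Ioo (Finset.mem_coe.1 hj)
      rcases hP.node_eq_shrink (by omega) (Ioo_subset_Icc_self hjI) h.symm with ⟨h1, -⟩ | ⟨h1, -⟩
      · exact hjI.1.ne' h1
      · exact hjI.2.ne h1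
    · have hx2 := hP.shrink_mem hx
      rcases hP.node_eq_shrink (by omega) (hP.shrink_mem_unit hx) h.symm with ⟨h1, h2⟩ | ⟨h1, h2⟩
      · rw [h1, ← h2] at hx2
        exact not_lt.2 hx2.1 hkI.1
      · rw [h1, ← h2] at hx2
        exact not_lt.2 hx2.2 hkI.2
  obtain ⟨φ, hφ, hφk, hφK⟩ := exists_bump hn hKc hkI hkK
  have hφj : ∀ j ∈ Finset.Icc 1 (N - 1), j ≠ k → φ (node a j) = 0 := by
    intro j hj hjk
    refine hφK _ (Or.inl (Or.inl ⟨j, ?_, rfl⟩))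
    have := Finset.mem_Icc.1 hj
    exact Finset.mem_coe.2 (Finset.mem_erase.2 ⟨hjk, Finset.mem_range.2 (by omega)⟩)
  refine ⟨φ, hφ, hφk, hφj, fun g hg => ?_⟩
  rw [hP.massForm_eq_iterate (contDiff_mulConj hg (contDiff_one hn hφ))
    (fun _ => by simp [mulConj, eval_zero hn hφ]) (fun _ => by simp [mulConj, eval_one hn hφ]) 2]
  have h1 : massForm N β P (fun x => mulConj g φ ((shrink a m)^[2] x)) = 0 := by
    refine massForm_eq_zero fun x hx => ?_
    have := hφK ((shrink a m)^[2] x) (Or.inr ⟨x, hx, rfl⟩)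
    rw [mulConj, this, zero_mul]
  rw [h1, mul_zero, add_zero, Finset.sum_range_succ, Finset.sum_range_one]
  have h2 : ∑ i ∈ Finset.Icc 1 (N - 1), (zeta N β d m i : ℂ) *
      mulConj g φ ((shrink a m)^[1] (node a i)) = 0 := by
    refine Finset.sum_eq_zero fun i hi => ?_
    have := hφK ((shrink a m)^[1] (node a i)) (Or.inl (Or.inr ⟨i, hi, rfl⟩))
    rw [mulConj, this, zero_mul, mul_zero]
  rw [h2, mul_zero, add_zero, pow_zero, one_mul, Finset.sum_eq_single k]
  · simp [mulConj, hφk]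
  · intro j hj hjk
    simp [mulConj, hφj j hj hjk]
  · intro h; exact absurd hk h

/-- The action of the similarity of `[0, 1]` onto its `m`-th piece in the energy space. -/
theorem exists_shift (hP : IsZeroSpectralOrder N a β d m P) (hn : 1 < n) :
    ∃ V : EnergySpace hn →ₗ[ℂ] EnergySpace hn,
      (∀ w, a m ^ (2 * n - 1) * ‖V w‖ ^ 2 = ‖w‖ ^ 2) ∧
      (∀ w, ∀ k ∈ Finset.Icc 1 (N - 1), rep hn (V w) (node a k) = 0) ∧
      ∀ w, ⟪massOp N β P hn (V w), V w⟫ = d m * ⟪massOp N β P hn w, w⟫ := by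
  have hm := Finset.mem_Icc.1 hP.m_mem
  have ha := hP.a_pos m hP.m_mem
  have hadd := node_sub_one_add a hm.1
  -- x ↦ p + hx is the inverse of S, so composing with it squeezes a function into the `m`-th piece.
  set h := (a m)⁻¹ with hh
  set p := -(node a (m - 1)) * h with hpdef
  have hh0 : 0 < h := by positivity
  have hah : a m * h = 1 := mul_inv_cancel₀ ha.ne'
  have hp : p ≤ 0 := by
    have := (hP.node_mem (by omega : m - 1 ≤ N)).1
    rw [hpdef]; nlinarith
  have hph : 1 ≤ p + h := by
    have h1 := (hP.node_mem hm.2).2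
    have h2 : p + h = (1 - node a m) * h + 1 := by
      rw [hpdef, ← hadd]; linear_combination hah
    rw [h2]
    have := mul_nonneg (sub_nonneg.2 h1) hh0.le
    linarith
  have hmem := fun w : EnergySpace hn => comp_affine_mem_sobolevZero hn (rep_mem hn w) hh0 hp hph
  let V : EnergySpace hn →ₗ[ℂ] EnergySpace hn :=
    { toFun := fun w => sobolevEquiv hn ⟨_, hmem w⟩
      map_add' := fun w w' => by
        rw [← map_add]
        congr 1
        refine Subtype.ext (funext fun x => ?_)
        change rep hn (w + w') _ = rep hn w _ + rep hn w' _
        rw [rep_add]; rfl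
      map_smul' := fun c w => by
        rw [RingHom.id_apply, ← map_smul]
        congr 1
        refine Subtype.ext (funext fun x => ?_)
        change rep hn (c • w) _ = c • rep hn w _
        rw [rep_smul]; rfl }
  have hrep : ∀ w, rep hn (V w) = fun x => rep hn w (p + h * x) := fun w =>
    rep_sobolevEquiv hn ⟨_, hmem w⟩
  have hnode : ∀ w, ∀ k ∈ Finset.Icc 1 (N - 1), rep hn (V w) (node a k) = 0 := by
    intro w k hk
    have hk' := Finset.mem_Icc.1 hk
    rw [hrep]
    have := iteratedDeriv_eq_zero_of_le_or_ge (rep_mem hn w) (k := 0) (by omega)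
      (x := p + h * node a k) ?_
    · simpa using this
    · rcases (show k ≤ m - 1 ∨ m ≤ k by omega) with h1 | h1
      · left
        have := hP.node_le h1 (by omega)
        rw [hpdef]; nlinarith
      · right
        have h3 := hP.node_le h1 (by omega)
        have h2 : p + h * node a k = (node a k - node a m) * h + 1 := by
          rw [hpdef, ← hadd]; linear_combination hah
        rw [h2]
        have := mul_nonneg (sub_nonneg.2 h3) hh0.le
        linarith
  refine ⟨V, fun w => ?_, hnode, fun w => ?_⟩
  · have h1 := norm_topDeriv_comp_affine_sq hn (rep_mem hn w) hh0 hp hph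
    rw [norm_topDeriv_rep] at h1
    have h2 : ‖V w‖ ^ 2 = h ^ (2 * n - 1) * ‖w‖ ^ 2 := h1
    rw [h2, ← mul_assoc, ← mul_pow, hah, one_pow, one_mul]
  · rw [inner_massOp, inner_massOp, hP.massForm_rep_eq hn (V w) (V w) 1, Finset.sum_range_one,
      Finset.sum_eq_zero, mul_zero, zero_add, pow_one]
    · congr 2
      funext x
      have h1 : p + h * shrink a m x = x := by
        rw [hpdef, shrink]; linear_combination x * hah
      rw [Function.iterate_one, mulConj, hrep]
      simp only [h1]
      rfl
    · intro i hi
      have := hnode w i hi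
      simp [mulConj, this]

end Construction

end Asymptotics

/-! ### Enlarging negative subspaces -/

section Asymptotics

variable {n N : ℕ} {a β d : ℕ → ℝ} {m : ℕ} {P : L2}

local notation "⟪" x "," y "⟫" => inner ℂ x y

/-- Test functions at the negative atoms of the first generation span a space on which the form is
negative definite. -/
theorem exists_negative_span (hP : IsZeroSpectralOrder N a β d m P) (hn : 1 < n) :
    ∃ (Φ : (negIndices N β d m → ℂ) →ₗ[ℂ] EnergySpace hn) (c₀ : ℝ), 0 < c₀ ∧
      (∀ c, Φ c = 0 → c = 0) ∧
      (∀ c, (⟪massOp N β P hn (Φ c), Φ c⟫).re ≤ -c₀ * ‖Φ c‖ ^ 2) ∧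
      ∀ u, (∀ k ∈ Finset.Icc 1 (N - 1), rep hn u (node a k) = 0) → ∀ c,
        ⟪massOp N β P hn u, Φ c⟫ = 0 := by
  classical
  have hsub : ∀ i : negIndices N β d m, (i : ℕ) ∈ Finset.Icc 1 (N - 1) := fun i =>
    (Finset.mem_filter.1 i.2).1
  have hneg : ∀ i : negIndices N β d m, zeta N β d m i < 0 := fun i =>
    (Finset.mem_filter.1 i.2).2
  choose φ hφ hφ1 hφ0 hφform using fun i : negIndices N β d m =>
    exists_test_function hP hn (hsub i)
  let v : negIndices N β d m → EnergySpace hn := fun i => sobolevEquiv hn ⟨φ i, hφ i⟩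
  have hrep : ∀ i, rep hn (v i) = φ i := fun i => rep_sobolevEquiv hn ⟨φ i, hφ i⟩
  let Φ : (negIndices N β d m → ℂ) →ₗ[ℂ] EnergySpace hn := Fintype.linearCombination ℂ v
  have hΦ : ∀ c, Φ c = ∑ i, c i • v i := fun c => Fintype.linearCombination_apply ℂ v c
  have hin : ∀ u i, ⟪massOp N β P hn u, v i⟫ =
      zeta N β d m i * starRingEnd ℂ (rep hn u (node a i)) := by
    intro u i
    rw [inner_massOp, hrep, hφform i _ (contDiff_rep hn u)]
  -- The coefficients are the nodal values. Hence Φ is injective and the form is diagonal in `c`.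
  have hval : ∀ c (i : negIndices N β d m), rep hn (Φ c) (node a i) = c i := by
    intro c i
    have hsum : ∀ s : Finset (negIndices N β d m), rep hn (∑ j ∈ s, c j • v j) (node a i) =
        ∑ j ∈ s, c j * φ j (node a i) := by
      intro s
      induction s using Finset.induction_on with
      | empty =>
        have : rep hn (0 : EnergySpace hn) = 0 := by
          have := rep_smul hn 0 (0 : EnergySpace hn)
          simpa using this
        simp [this]
      | insert j s hj ih =>
        rw [Finset.sum_insert hj, Finset.sum_insert hj, rep_add, Pi.add_apply, ih, rep_smul, hrep]
        rfl
    rw [hΦ, hsum, Finset.sum_eq_single i]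
    · rw [hφ1, mul_one]
    · intro j _ hji
      rw [hφ0 j _ (hsub i) (fun h => hji (Subtype.ext h.symm)), mul_zero]
    · simp
  have hform : ∀ c, ⟪massOp N β P hn (Φ c), Φ c⟫ =
      ((∑ i : negIndices N β d m, zeta N β d m i * ‖c i‖ ^ 2 : ℝ) : ℂ) := by
    intro c
    conv_lhs => rw [hΦ c, inner_sum, ← hΦ c]
    push_cast
    refine Finset.sum_congr rfl fun i _ => ?_
    rw [inner_smul_right, hin, hval, mul_left_comm, Complex.mul_conj, Complex.normSq_eq_norm_sq]
    push_cast; rfl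
  have hz0 : ∃ z₀ : ℝ, 0 < z₀ ∧ ∀ i : negIndices N β d m, zeta N β d m i ≤ -z₀ := by
    rcases isEmpty_or_nonempty (negIndices N β d m) with h | h
    · exact ⟨1, one_pos, fun i => isEmptyElim i⟩
    · obtain ⟨i, -, hi⟩ := Finset.exists_max_image (Finset.univ : Finset (negIndices N β d m))
        (fun i => zeta N β d m i) Finset.univ_nonempty
      exact ⟨-zeta N β d m i, neg_pos.2 (hneg i), fun j => by
        rw [neg_neg]; exact hi j (Finset.mem_univ _)⟩
  obtain ⟨z₀, hz₀, hz⟩ := hz0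
  -- By Cauchy–Schwarz ‖Φ c‖² ≤ B Σ|c_i|², while the form is at most -z₀ Σ|c_i|². The constant z₀/(B
  -- + 1) avoids dividing by B, which is 0 if there are no negative indices.
  set B := ∑ i, ‖v i‖ ^ 2 with hB
  have hB0 : 0 ≤ B := Finset.sum_nonneg fun i _ => by positivity
  have hnorm : ∀ c, ‖Φ c‖ ^ 2 ≤ B * ∑ i, ‖c i‖ ^ 2 := by
    intro c
    have h1 : ‖Φ c‖ ≤ ∑ i, ‖v i‖ * ‖c i‖ := by
      rw [hΦ]
      refine (norm_sum_le _ _).trans_eq (Finset.sum_congr rfl fun i _ => ?_)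
      rw [norm_smul, mul_comm]
    calc ‖Φ c‖ ^ 2 ≤ (∑ i, ‖v i‖ * ‖c i‖) ^ 2 := pow_le_pow_left₀ (norm_nonneg _) h1 2
      _ ≤ _ := Finset.sum_mul_sq_le_sq_mul_sq _ _ _
  refine ⟨Φ, z₀ / (B + 1), by positivity, ?_, ?_, ?_⟩
  · intro c hc
    funext i
    rw [← hval c i, hc]
    have := rep_smul hn 0 (0 : EnergySpace hn)
    rw [zero_smul, zero_smul] at this
    rw [this]; rfl
  · intro c
    rw [hform, Complex.ofReal_re]
    have h0 : 0 ≤ ∑ i, ‖c i‖ ^ 2 := Finset.sum_nonneg fun i _ => by positivity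
    have h1 : ∑ i : negIndices N β d m, zeta N β d m i * ‖c i‖ ^ 2 ≤ -z₀ * ∑ i, ‖c i‖ ^ 2 := by
      rw [Finset.mul_sum]
      exact Finset.sum_le_sum fun i _ => mul_le_mul_of_nonneg_right (hz i) (by positivity)
    have h2 : z₀ / (B + 1) * ‖Φ c‖ ^ 2 ≤ z₀ * ∑ i, ‖c i‖ ^ 2 := by
      rw [div_mul_eq_mul_div, div_le_iff₀ (by positivity)]
      have := mul_le_mul_of_nonneg_left (hnorm c) hz₀.le
      nlinarith [mul_nonneg hz₀.le h0]
    linarith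
  · intro u hu c
    rw [hΦ, inner_sum]
    refine Finset.sum_eq_zero fun i _ => ?_
    rw [inner_smul_right, hin, hu _ (hsub i)]
    simp

/-- Cauchy–Schwarz with weights. Reciprocals of the weights add, so s = q/T and c = c₀ produce T/q +
c₀⁻¹: the cost of the new directions is additive in T. -/
theorem sq_add_le_of_weights {s c u v : ℝ} (hs : 0 < s) (hc : 0 < c) :
    (s⁻¹ + c⁻¹)⁻¹ * (u + v) ^ 2 ≤ s * u ^ 2 + c * v ^ 2 := by
  rw [inv_mul_le_iff₀ (by positivity)]
  have h : (s⁻¹ + c⁻¹) * (s * u ^ 2 + c * v ^ 2) - (u + v) ^ 2 = (s * u - c * v) ^ 2 / (s * c) := by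
    field_simp
    ring
  have h2 : 0 ≤ (s * u - c * v) ^ 2 / (s * c) := by positivity
  linarith

/-- Each similarity step adds `Zneg` negative directions. -/
theorem exists_negative_subspace_step (hP : IsZeroSpectralOrder N a β d m P) (hn : 1 < n)
    (hd : 0 < d m) : ∃ C : ℝ, 0 < C ∧ ∀ L : Submodule ℂ (EnergySpace hn),
      FiniteDimensional ℂ L → ∀ T : ℝ, 0 < T →
      (∀ y ∈ L, (⟪massOp N β P hn y, y⟫).re ≤ -T⁻¹ * ‖y‖ ^ 2) →
      ∃ L' : Submodule ℂ (EnergySpace hn), FiniteDimensional ℂ L' ∧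
        Module.finrank ℂ L' = Module.finrank ℂ L + Zneg N β d m ∧
        ∀ y ∈ L', (⟪massOp N β P hn y, y⟫).re ≤
          -(T / (a m ^ (2 * n - 1) * d m) + C)⁻¹ * ‖y‖ ^ 2 := by
  obtain ⟨V, hVnorm, hVnode, hVform⟩ := exists_shift hP hn
  obtain ⟨Φ, c₀, hc₀, hΦinj, hΦneg, hΦorth⟩ := exists_negative_span hP hn
  set A := massOp N β P hn with hA
  have hsymm := massOp_isSymmetric N β P hn
  set q := a m ^ (2 * n - 1) * d m with hq
  have hq0 : 0 < q := hP.ratio_pos hd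
  refine ⟨c₀⁻¹, by positivity, fun L hL T hT hLT => ?_⟩
  -- The squeezed copy of `L` and the bumps are orthogonal for the form of `A`, but not necessarily
  -- for the energy inner product; hence the weighted inequality for the norm of the sum.
  let Ψ : (L × (negIndices N β d m → ℂ)) →ₗ[ℂ] EnergySpace hn :=
    (V.comp L.subtype).coprod Φ
  have hΨ : ∀ p, Ψ p = V p.1 + Φ p.2 := fun p => rfl
  have hexp : ∀ p, (⟪A (Ψ p), Ψ p⟫).re =
      (⟪A (V p.1), V p.1⟫).re + (⟪A (Φ p.2), Φ p.2⟫).re := by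
    intro p
    have h1 : ⟪A (V p.1), Φ p.2⟫ = 0 := hΦorth _ (hVnode p.1) _
    have h2 : ⟪A (Φ p.2), V p.1⟫ = 0 := by
      have h3 : ⟪A (Φ p.2), V p.1⟫ = ⟪Φ p.2, A (V p.1)⟫ := hsymm _ _
      rw [h3, ← inner_conj_symm, h1, map_zero]
    rw [hΨ, map_add, inner_add_left, inner_add_right, inner_add_right, h1, h2]
    simp
  -- The form scales by d_m and the squared norm by a_m^-(2n-1), so the bound 1/T becomes q/T.
  have hV : ∀ p : L × (negIndices N β d m → ℂ),
      (⟪A (V p.1), V p.1⟫).re ≤ -(q / T) * ‖V p.1‖ ^ 2 := by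
    intro p
    rw [hVform, Complex.re_ofReal_mul]
    have h1 := mul_le_mul_of_nonneg_left (hLT p.1 p.1.2) hd.le
    refine h1.trans_eq ?_
    rw [← hVnorm, hq]
    field_simp
  have hbound : ∀ p, (⟪A (Ψ p), Ψ p⟫).re ≤
      -(q / T * ‖V p.1‖ ^ 2 + c₀ * ‖Φ p.2‖ ^ 2) := by
    intro p
    rw [hexp]
    linarith [hV p, hΦneg p.2]
  have hinj : Function.Injective Ψ := by
    rw [← LinearMap.ker_eq_bot, LinearMap.ker_eq_bot']
    intro p hp
    have h1 := hbound p
    rw [hp, map_zero, inner_zero_left, Complex.zero_re] at h1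
    have h2 : 0 ≤ q / T * ‖V p.1‖ ^ 2 := by positivity
    have h3 : 0 ≤ c₀ * ‖Φ p.2‖ ^ 2 := by positivity
    have h4 : Φ p.2 = 0 := by
      have : c₀ * ‖Φ p.2‖ ^ 2 = 0 := by linarith
      simpa [hc₀.ne'] using this
    have h5 : V p.1 = 0 := by
      have : q / T * ‖V p.1‖ ^ 2 = 0 := by linarith
      simpa [hq0.ne', hT.ne'] using this
    have h6 : (p.1 : EnergySpace hn) = 0 := by
      have := hVnorm p.1
      rw [h5, norm_zero] at this
      simpa using this.symm
    exact Prod.ext (Subtype.ext h6) (hΦinj _ h4)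
  refine ⟨LinearMap.range Ψ, inferInstance, ?_, ?_⟩
  · rw [LinearMap.finrank_range_of_inj hinj, Module.finrank_prod, Module.finrank_pi]
    rw [Fintype.card_coe]; rfl
  · rintro _ ⟨p, rfl⟩
    refine (hbound p).trans ?_
    have h1 := sq_add_le_of_weights (u := ‖V p.1‖) (v := ‖Φ p.2‖)
      (show 0 < q / T by positivity) hc₀
    rw [inv_div] at h1
    have h2 : ‖Ψ p‖ ^ 2 ≤ (‖V p.1‖ + ‖Φ p.2‖) ^ 2 :=
      pow_le_pow_left₀ (norm_nonneg _) (norm_add_le _ _) 2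
    have h3 : (T / q + c₀⁻¹)⁻¹ * ‖Ψ p‖ ^ 2 ≤ (T / q + c₀⁻¹)⁻¹ * (‖V p.1‖ + ‖Φ p.2‖) ^ 2 :=
      mul_le_mul_of_nonneg_left h2 (by positivity)
    linarith

end Asymptotics

end SelfSimilarSpectrum

/-! ### Assembly of the theorem -/

theorem mainTheorem2 (n : ℕ) (hn : 1 < n) (N : ℕ) (a β d : ℕ → ℝ) (m : ℕ)
    (P : SelfSimilarSpectrum.L2)
    (hP : SelfSimilarSpectrum.IsZeroSpectralOrder N a β d m P)
    (hd : 0 < d m)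
    (hZneg : 0 < SelfSimilarSpectrum.Zneg N β d m)
    (hZ : SelfSimilarSpectrum.Zpos N β d m + SelfSimilarSpectrum.Zneg N β d m = N - 1) :
    ∃ ev : ℕ → ℝ, SelfSimilarSpectrum.IsNegEigenvalueSeq hn P ev ∧
      ∃ τ : ℕ → ℝ, ∀ l ∈ Finset.Icc 1 (SelfSimilarSpectrum.Zneg N β d m),
        0 < τ l ∧
        Asymptotics.IsEquivalent Filter.atTop
          (fun k : ℕ => ev (l + k * SelfSimilarSpectrum.Zneg N β d m))
          (fun k : ℕ => -τ l * ((a m ^ (2 * n - 1) * d m) ^ k)⁻¹) := by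
  open SelfSimilarSpectrum in
  obtain ⟨C, hC, hstep⟩ := exists_negative_subspace_step hP hn hd
  have hq := hP.ratio_pos (n := n) hd
  -- The codimension excess `c` is n here: the conditions on the derivatives of orders 0, …, n - 1
  -- at the left end of the k-th nested piece.
  obtain ⟨s, hpos, hmono, hmult, hlim⟩ := exists_negative_spectrum_asymptotics
    (massOp_isCompact hP hn hd) (massOp_isSymmetric N β P hn) hq (hP.ratio_lt_one hn hd) hZneg hC
    (massBound_pos N β P) hstep (massOp_lower_bound hP hn hd)
  choose! τ hτ hτlim using hlim
  refine ⟨fun k => -s k, ⟨fun k hk => neg_neg_of_pos (hpos k hk),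
    fun j k hj hjk => neg_le_neg (hmono j k hj hjk), fun x hx => ?_, fun x hx => ?_⟩,
    τ, fun l hl => ?_⟩
  · have hx' : 0 < -x := neg_pos.2 hx
    have h1 := SelfSimilarSpectrum.eigenspace_eq_map N β P hn hx'.ne'
    rw [neg_neg] at h1
    have := (hmult (-x) hx').1
    rw [h1]
    infer_instance
  · have hx' : 0 < -x := neg_pos.2 hx
    have h1 := SelfSimilarSpectrum.finrank_eigenspace_eq N β P hn hx'.ne'
    rw [neg_neg] at h1
    rw [h1, ← (hmult (-x) hx').2]
    congr 1
    ext k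
    simp only [Set.mem_ofPred_eq]
    rw [neg_eq_iff_eq_neg]
  · have hl := (Finset.mem_Icc.1 hl).1
    refine ⟨hτ l hl, ?_⟩
    have hne : ∀ k : ℕ, -τ l * ((a m ^ (2 * n - 1) * d m) ^ k)⁻¹ ≠ 0 := fun k =>
      mul_ne_zero (neg_ne_zero.2 (hτ l hl).ne') (inv_ne_zero (pow_ne_zero _ hq.ne'))
    rw [Asymptotics.isEquivalent_iff_tendsto_one (Filter.Eventually.of_forall hne)]
    have h1 := (hτlim l hl).div_const (τ l)
    rw [div_self (hτ l hl).ne'] at h1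
    refine h1.congr fun k => ?_
    have h2 : (a m ^ (2 * n - 1) * d m) ^ k ≠ 0 := pow_ne_zero _ hq.ne'
    have h3 := (hτ l hl).ne'
    rw [Pi.div_apply]
    field_simp
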